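/- Let $0<\alpha\le 1$ and $p\ge 1$. Let $\mathbf T=(t_{ij})$ be a $p\times p$ sub-intensity matrix, i.e. $\lambda_i:=-t_{ii}>0$, $t_{ij}\ge 0$ for $i\ne j$, and $\mathbf t:=-\mathbf T\mathbf e\ge 0$, where $\mathbf e$ is the column vector of ones. Let $\boldsymbol\pi$ be a probability vector on $\{1,\dots,p\}$. Let $(J_n)_{n\ge 0}$ be the Markov chain on $\{1,\dots,p+1\}$ with initial distribution $(\boldsymbol\pi,0)$ and transition probabilities $q_{ii}=0$, $q_{ij}=t_{ij}/\lambda_i$ ($i\neq j$), $q_{i,p+1}=t_i/\lambda_i$ for $i,j\le p$, with $p+1$ absorbing; assume that the states $1,\dots,p$ are transient (equivalently, $p+1$ can be reached from each of them). Let $H^i_n$ ($i\le p$, $n\ge 0$) be independent random variables, independent of the chain, where $H^i_n$ has the Mittag-Leffler density $$\lambda_i x^{\alpha-1}\sum_{k\ge 0}\frac{(-\lambda_i x^{\alpha})^k}{\Gamma(\alpha k+\alpha)},\qquad x>0 .$$ Let $S_0=0$ and $S_{n+1}=S_n+H^{J_n}_n$ (with $S_{n+1}=\infty$ if $J_n=p+1$),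 and let $X_t=J_n$ for $S_n\le t<S_{n+1}$. Let $\tau=\inf\{t\ge 0: X_t=p+1\}$, so that $\tau\sim \mathrm{PH}_\alpha(\boldsymbol\pi,\mathbf T)$. Here, for a sub-intensity matrix $\mathbf S$ with transient states and a nonnegative vector $\boldsymbol\beta$ with $\boldsymbol\beta\mathbf e\le 1$, $\mathrm{PH}_\alpha(\boldsymbol\beta,\mathbf S)$ denotes the measure on $[0,\infty)$ of total mass $\boldsymbol\beta\mathbf e$ with Laplace transform $u\mapsto\boldsymbol\beta(u^\alpha\mathbf I-\mathbf S)^{-1}(-\mathbf S\mathbf e)$, $u\ge 0$. Let $\mathbf r=(r_1,\dots,r_p)$ be a non-zero vector of nonnegative rewards and let $$Y=\int_0^\tau\sum_{i=1}^p r_i 1\{X_t=i\}\,dt .$$ Let $E_+=\{i\le p: r_i>0\}$, $E_0=\{i\le p: r_i=0\}$, decompose $\boldsymbol\pi=(\boldsymbol\pi_+,\boldsymbol\pi_0)$ and $\mathbf T=\begin{pmatrix}\mathbf T_{++}&\mathbf T_{+0}\\ \mathbf T_{0+}&\mathbf T_{00}\end{pmatrix}$ accordingly, and let $\boldsymbol\Delta(\mathbf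 r_+^\alpha)$ be the diagonal matrix with entries $r_i^\alpha$, $i\in E_+$. Then $\mathbf T_{00}$ is invertible, and with $$\tilde{\boldsymbol\pi}=\boldsymbol\pi_++\boldsymbol\pi_0(-\mathbf T_{00})^{-1}\mathbf T_{0+},\qquad \tilde{\mathbf T}=\boldsymbol\Delta(\mathbf r_+^\alpha)^{-1}\left(\mathbf T_{++}+\mathbf T_{+0}(-\mathbf T_{00})^{-1}\mathbf T_{0+}\right),$$ $\tilde{\boldsymbol\pi}$ is nonnegative with $\tilde{\boldsymbol\pi}\mathbf e\le 1$, $\tilde{\mathbf T}$ is a sub-intensity matrix with transient states, $u^\alpha\mathbf I-\tilde{\mathbf T}$ is invertible for every $u\ge 0$, $Y$ is almost surely finite, and the law of $Y$ is the sum of the measure $\mathrm{PH}_\alpha(\tilde{\boldsymbol\pi},\tilde{\mathbf T})$, which is absolutely continuous with respect to Lebesgue measure, and an atom at zero of size $1-\tilde{\boldsymbol\pi}\mathbf e$. -/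

import Mathlib

open MeasureTheory ProbabilityTheory
open scoped ENNReal Matrix

noncomputable section

/-- The Mittag-Leffler function `E_{a,b}(z) = ∑ z ^ k / Γ (a k + b)` on the real line. -/
def mittagLeffler (a b z : ℝ) : ℝ :=
  ∑' k : ℕ, z ^ k / Real.Gamma (a * k + b)

/-- The Mittag-Leffler distribution `ML(a, l)`, with density
`l * x ^ (a - 1) * E_{a,a} (- l * x ^ a)` on `(0, ∞)`. -/
def mlMeasure (a l : ℝ) : Measure ℝ :=
  (volume.restrict (Set.Ioi 0)).withDensity fun x =>
    ENNReal.ofReal (l * x ^ (a - 1) * mittagLeffler a a (-l * x ^ a))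

section PhaseType

variable {ι : Type*} [Fintype ι] [DecidableEq ι]

/-- The exit rate vector `t = - T e`. -/
def exitRates (T : Matrix ι ι ℝ) : ι → ℝ := -(T *ᵥ 1)

/-- The transition matrix `Q` of the embedded jump chain. The state space is `Option ι`: the states
`some i` are the phases and `none` is the absorbing state. The holding parameter of the phase `i` is
`λ_i = - T i i`; one has `q_ii = 0` and `q_ij = t_ij / λ_i`, `q_{i,none} = t_i / λ_i`. -/
def jumpMatrix (T : Matrix ι ι ℝ) : Matrix (Option ι) (Option ι) ℝ
  | some i, some j => if i = j then 0 else T i j / (-T i i)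
  | some i, none => exitRates T i / (-T i i)
  | none, some _ => 0
  | none, none => 1

/-- `T` is the sub-intensity matrix of a process with transient phases and one absorbing state.
The state space is finite and absorption is the only absorbing class, so the phases are all
transient exactly when absorption can be reached from each of them. -/
structure IsTransientSubIntensity (T : Matrix ι ι ℝ) : Prop where
  diag_neg : ∀ i, T i i < 0
  offDiag_nonneg : ∀ i j, i ≠ j → 0 ≤ T i j
  exit_nonneg : ∀ i, 0 ≤ exitRates T i
  transient : ∀ i, ∃ n : ℕ, 0 < (jumpMatrix T ^ n) (some i) none

/-- `μ` is the fractional phase-type distribution `PH_a(π, T)`: it is the finite measure on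
`[0, ∞)` with Laplace transform `π (u ^ a I - T)⁻¹ t` for `u ≥ 0`, where `t = - T e`.
The initial vector `π` may be defective (`π e ≤ 1`), and then `μ` has total mass `π e`, which
is the value of the transform at `u = 0`. -/
structure IsFracPhaseType (a : ℝ) (π : ι → ℝ) (T : Matrix ι ι ℝ) (μ : Measure ℝ) : Prop where
  init_nonneg : ∀ i, 0 ≤ π i
  init_sum_le : ∑ i, π i ≤ 1
  subIntensity : IsTransientSubIntensity T
  isUnit : ∀ u : ℝ, 0 ≤ u → IsUnit ((u ^ a) • (1 : Matrix ι ι ℝ) - T)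
  finite : IsFiniteMeasure μ
  nonneg : μ (Set.Iio 0) = 0
  laplace : ∀ u : ℝ, 0 ≤ u →
    ∫ x, Real.exp (-u * x) ∂μ
      = π ⬝ᵥ (((u ^ a) • (1 : Matrix ι ι ℝ) - T)⁻¹ *ᵥ exitRates T)

end PhaseType

section SemiMarkov

variable {ι Ω : Type*}

/-- The state space `Option ι` of the jump chain carries the discrete σ-algebra. -/
instance instMeasurableSpaceOptionState : MeasurableSpace (Option ι) := ⊤

/-- The data of the Markov renewal construction: `J` is the Markov chain with initial distribution
`π` on the phases and transition matrix `Q`, and `H i n` are independent `ML(a, λ_i)` variables,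
independent of the chain; `H i n` is the holding time used if the `n`-th visited state
(counted from `0`) is the phase `i`. -/
structure IsMLMarkovRenewal [Fintype ι] [DecidableEq ι] [MeasurableSpace Ω] (P : Measure Ω)
    (a : ℝ) (π : ι → ℝ) (T : Matrix ι ι ℝ)
    (J : ℕ → Ω → Option ι) (H : ι → ℕ → Ω → ℝ) : Prop where
  measurable_chain : ∀ n, Measurable (J n)
  measurable_hold : ∀ i n, Measurable (H i n)
  chain_law : ∀ (n : ℕ) (x : ℕ → Option ι),
    P {ω | ∀ k ≤ n, J k ω = x k} =
      ENNReal.ofReal ((x 0).elim 0 π * ∏ k ∈ Finset.range n, jumpMatrix T (x k) (x (k + 1)))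
  hold_law : ∀ i n, P.map (H i n) = mlMeasure a (-T i i)
  indep_hold : iIndepFun (fun (q : ι × ℕ) (ω : Ω) => H q.1 q.2 ω) P
  indep_chain_hold :
    IndepFun (fun (ω : Ω) (n : ℕ) => J n ω) (fun (ω : Ω) (q : ι × ℕ) => H q.1 q.2 ω) P

/-- The time spent in the `n`-th visited state; it is infinite in the absorbing state. -/
def sojourn (J : ℕ → Ω → Option ι) (H : ι → ℕ → Ω → ℝ) (n : ℕ) (ω : Ω) : ℝ≥0∞ :=
  (J n ω).elim ⊤ fun i => ENNReal.ofReal (H i n ω)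

/-- The time `S_n` of the `n`-th jump, with `S_0 = 0`. -/
def jumpTime (J : ℕ → Ω → Option ι) (H : ι → ℕ → Ω → ℝ) (n : ℕ) (ω : Ω) : ℝ≥0∞ :=
  ∑ k ∈ Finset.range n, sojourn J H k ω

open Classical in
/-- The semi-Markov process: `X_t = J n` for `S_n ≤ t < S_{n+1}`. (Such an `n` is unique. If
there is none, that is if infinitely many jumps occur before `t`, which is a null event, the state
is put to `none`.) -/
def semiMarkov (J : ℕ → Ω → Option ι) (H : ι → ℕ → Ω → ℝ) (t : ℝ) (ω : Ω) : Option ι :=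
  if h : ∃ n : ℕ, jumpTime J H n ω ≤ ENNReal.ofReal t ∧ ENNReal.ofReal t < jumpTime J H (n + 1) ω
  then J (Nat.find h) ω
  else none

/-- The absorption time `τ = inf {t ≥ 0 | X_t is the absorbing state}` (`∞` if there is no such
`t`). -/
def absorptionTime (X : ℝ → Ω → Option ι) (ω : Ω) : ℝ≥0∞ :=
  ⨅ (t : ℝ) (_ : 0 ≤ t) (_ : X t ω = none), ENNReal.ofReal t

open Classical in
/-- The total reward `∫_0^τ ∑ i, r i * 1{X_t = i} dt` for nonnegative reward rates `r`. -/
def totalReward [Fintype ι] (r : ι → ℝ) (X : ℝ → Ω → Option ι) (ω : Ω) : ℝ≥0∞ :=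
  ∫⁻ t in {t : ℝ | 0 ≤ t ∧ ENNReal.ofReal t < absorptionTime X ω},
    ∑ i, if X t ω = some i then ENNReal.ofReal (r i) else 0

end SemiMarkov

section Reward

variable {ι : Type*} [Fintype ι] [DecidableEq ι]

/-- `E_+` consists of the phases with positive reward. -/
abbrev PosPhase (r : ι → ℝ) : Type _ := {i : ι // 0 < r i}

/-- `E_0` consists of the phases with reward zero. -/
abbrev ZeroPhase (r : ι → ℝ) : Type _ := {i : ι // r i = 0}

/-- The block `T_{++}` of `T`. -/
def blockPP (r : ι → ℝ) (T : Matrix ι ι ℝ) : Matrix (PosPhase r) (PosPhase r) ℝ :=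
  T.submatrix Subtype.val Subtype.val

/-- The block `T_{+0}` of `T`. -/
def blockPZ (r : ι → ℝ) (T : Matrix ι ι ℝ) : Matrix (PosPhase r) (ZeroPhase r) ℝ :=
  T.submatrix Subtype.val Subtype.val

/-- The block `T_{0+}` of `T`. -/
def blockZP (r : ι → ℝ) (T : Matrix ι ι ℝ) : Matrix (ZeroPhase r) (PosPhase r) ℝ :=
  T.submatrix Subtype.val Subtype.val

/-- The block `T_{00}` of `T`. -/
def blockZZ (r : ι → ℝ) (T : Matrix ι ι ℝ) : Matrix (ZeroPhase r) (ZeroPhase r) ℝ :=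
  T.submatrix Subtype.val Subtype.val

/-- `π̃ = π_+ + π_0 (-T_{00})⁻¹ T_{0+}`. -/
def rewardInit (π : ι → ℝ) (T : Matrix ι ι ℝ) (r : ι → ℝ) : PosPhase r → ℝ :=
  (fun i : PosPhase r => π i) + (fun i : ZeroPhase r => π i) ᵥ* ((-blockZZ r T)⁻¹ * blockZP r T)

/-- `T̃ = Δ(r_+ ^ a)⁻¹ (T_{++} + T_{+0} (-T_{00})⁻¹ T_{0+})`. -/
def rewardSubIntensity (a : ℝ) (T : Matrix ι ι ℝ) (r : ι → ℝ) :
    Matrix (PosPhase r) (PosPhase r) ℝ :=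
  (Matrix.diagonal fun i : PosPhase r => r i ^ a)⁻¹ *
    (blockPP r T + blockPZ r T * (-blockZZ r T)⁻¹ * blockZP r T)

end Reward

end

/-!
The Mittag-Leffler density has Laplace transform `l / (l + u ^ a)`, so discounting the reward by
`exp (-u Y)` amounts to killing the process in phase `i` with probability
`(u r_i) ^ a / (λ_i + (u r_i) ^ a)` per visit. Summing over the paths of the jump chain, the
transform of `Y` at `u` is `π v`, where `v` solves `(Δ((u r) ^ a) - T) v = t`. Eliminating the
phases without reward from this system leaves `(u ^ a I - T̃) v_+ = t̃`. The constant that the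
elimination splits off is the limit of the transform as `u → ∞`, hence the atom of `Y` at `0`.

Two steps need more. That the Mittag-Leffler function gives a nonnegative density (for `a ≤ 1`) is
read off from its Laplace transform: the derivatives of `l / (l + u ^ a)` alternate in sign. And
away from `0` the law of `Y` is absolutely continuous because, along each of the countably many
paths of the jump chain, `Y` is a finite sum of independent variables, each of which is zero or
absolutely continuous.
-/

section MinimumPrinciple

variable {ι : Type*} [Fintype ι]

/-- The minimum principle for `S`: a vector `w` such that `S w` is nonpositive wherever `w` is
negative has no negative entry. Among matrices with nonnegative off-diagonal entries and exit rates
it singles out the sub-intensity matrices with transient states, and, unlike the reachability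
condition of `IsTransientSubIntensity`, it passes directly to blocks and Schur complements. -/
def MinimumPrinciple (S : Matrix ι ι ℝ) : Prop :=
  ∀ w : ι → ℝ, (∀ i, w i < 0 → (S *ᵥ w) i ≤ 0) → ∀ i, 0 ≤ w i

/-- A set `M` of phases that the process with sub-intensity matrix `T` cannot leave, neither to
another phase nor to absorption. -/
def IsClosedClass (T : Matrix ι ι ℝ) (M : Set ι) : Prop :=
  ∀ i ∈ M, exitRates T i = 0 ∧ ∀ j ∉ M, T i j = 0

lemma exitRates_apply (T : Matrix ι ι ℝ) (i : ι) : exitRates T i = -∑ j, T i j := by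
  simp [exitRates, Matrix.mulVec, dotProduct]

lemma mulVec_eq_sum_sub_sub_mul_exitRates (T : Matrix ι ι ℝ) (w : ι → ℝ) (m : ℝ) (i : ι) :
    (T *ᵥ w) i = ∑ j, T i j * (w j - m) - m * exitRates T i := by
  simp only [exitRates_apply, Matrix.mulVec, dotProduct, mul_sub, Finset.sum_sub_distrib,
    ← Finset.sum_mul]
  ring

lemma isClosedClass_setOf_eq_min {T : Matrix ι ι ℝ} (ho : ∀ i j, i ≠ j → 0 ≤ T i j)
    (he : ∀ i, 0 ≤ exitRates T i) {w : ι → ℝ} (hw : ∀ i, w i < 0 → (T *ᵥ w) i ≤ 0) {m : ℝ}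
    (hm : m < 0) (hmin : ∀ i, m ≤ w i) : IsClosedClass T {i | w i = m} := by
  intro i (hi : w i = m)
  have hterm : ∀ j ∈ Finset.univ, 0 ≤ T i j * (w j - m) := by
    intro j _
    obtain rfl | hij := eq_or_ne i j
    · simp [hi]
    · exact mul_nonneg (ho i j hij) (sub_nonneg.2 (hmin j))
  have hsum := Finset.sum_nonneg hterm
  have hexit : 0 ≤ -m * exitRates T i := mul_nonneg (by linarith) (he i)
  have hTw := hw i (hi ▸ hm)
  rw [mulVec_eq_sum_sub_sub_mul_exitRates T w m] at hTw
  refine ⟨(mul_eq_zero.1 (by linarith : m * exitRates T i = 0)).resolve_left hm.ne,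
    fun j hj => ?_⟩
  have hj0 := (Finset.sum_eq_zero_iff_of_nonneg hterm).1 (by linarith) j (Finset.mem_univ j)
  exact (mul_eq_zero.1 hj0).resolve_right (sub_ne_zero.2 hj)

lemma MinimumPrinciple.eq_empty_of_isClosedClass {T : Matrix ι ι ℝ} (hT : MinimumPrinciple T)
    {M : Set ι} (hM : IsClosedClass T M) : M = ∅ := by
  classical
  refine Set.eq_empty_of_forall_notMem fun i hi => ?_
  have hind := hT (fun j => if j ∈ M then -1 else 0) (fun j hj => ?_) i
  · norm_num [hi] at hind
  have hjM : j ∈ M := by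
    by_contra h
    simp [h] at hj
  obtain ⟨hexit, hout⟩ := hM j hjM
  rw [exitRates_apply, ← Finset.sum_neg_distrib] at hexit
  refine (Eq.trans (Finset.sum_congr rfl fun k _ => ?_) hexit).le
  by_cases hk : k ∈ M
  · simp [hk]
  · simp [hk, hout k hk]

lemma MinimumPrinciple.diag_neg {T : Matrix ι ι ℝ} (hT : MinimumPrinciple T) (i : ι) :
    T i i < 0 := by
  classical
  by_contra! h
  have hind := hT (-Pi.single i 1) (fun j hj => ?_) i
  · norm_num at hind
  obtain rfl : j = i := by
    by_contra hne
    simp [hne] at hj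
  simpa [Matrix.mulVec_neg] using h

variable [DecidableEq ι]

lemma jumpMatrix_nonneg {T : Matrix ι ι ℝ} (hd : ∀ i, T i i < 0)
    (ho : ∀ i j, i ≠ j → 0 ≤ T i j) (he : ∀ i, 0 ≤ exitRates T i) (x y : Option ι) :
    0 ≤ jumpMatrix T x y := by
  rcases x with _ | i <;> rcases y with _ | j <;> simp only [jumpMatrix]
  · exact zero_le_one
  · exact le_rfl
  · exact div_nonneg (he i) (neg_nonneg.2 (hd i).le)
  · split_ifs with h
    · exact le_rfl
    · exact div_nonneg (ho i j h) (neg_nonneg.2 (hd i).le)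

lemma IsClosedClass.jumpMatrix_pow_apply_none {T : Matrix ι ι ℝ} {M : Set ι}
    (hM : IsClosedClass T M) (n : ℕ) {i : ι} (hi : i ∈ M) :
    (jumpMatrix T ^ n) (some i) none = 0 := by
  induction n generalizing i with
  | zero => simp
  | succ n ih =>
    obtain ⟨hexit, hout⟩ := hM i hi
    have hnone : jumpMatrix T (some i) none = 0 := by simp [jumpMatrix, hexit]
    rw [pow_succ', Matrix.mul_apply, Fintype.sum_option, hnone, zero_mul, zero_add]
    refine Finset.sum_eq_zero fun j _ => ?_
    by_cases hj : j ∈ M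
    · rw [ih hj, mul_zero]
    · simp [jumpMatrix, hout j hj]

lemma isClosedClass_setOf_not_reach {T : Matrix ι ι ℝ} (hd : ∀ i, T i i < 0)
    (ho : ∀ i j, i ≠ j → 0 ≤ T i j) (he : ∀ i, 0 ≤ exitRates T i) :
    IsClosedClass T {i | ∀ n, (jumpMatrix T ^ n) (some i) none ≤ 0} := by
  intro i hi
  have hQ := jumpMatrix_nonneg hd ho he
  have hstep : ∀ n y, jumpMatrix T (some i) y * (jumpMatrix T ^ n) y none ≤ 0 := by
    intro n y
    refine le_trans ?_ (hi (n + 1))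
    rw [pow_succ', Matrix.mul_apply]
    exact Finset.single_le_sum
      (f := fun z => jumpMatrix T (some i) z * (jumpMatrix T ^ n) z none)
      (fun z _ => mul_nonneg (hQ _ _) (Matrix.pow_apply_nonneg hQ n _ _)) (Finset.mem_univ y)
  have hrate : 0 < -T i i := neg_pos.2 (hd i)
  constructor
  · have hexit : exitRates T i / -T i i ≤ 0 := by simpa [jumpMatrix] using hstep 0 none
    refine le_antisymm (not_lt.1 fun h => ?_) (he i)
    exact (div_pos h hrate).not_ge hexit
  · intro j hj
    have hij : i ≠ j := fun h => hj (h ▸ hi)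
    obtain ⟨n, hn⟩ := not_forall.1 hj
    have hjump := hstep n (some j)
    simp only [jumpMatrix, if_neg hij] at hjump
    refine le_antisymm (not_lt.1 fun h => ?_) (ho i j hij)
    exact (mul_pos (div_pos h hrate) (not_le.1 hn)).not_ge hjump

lemma IsTransientSubIntensity.minimumPrinciple {T : Matrix ι ι ℝ}
    (hT : IsTransientSubIntensity T) : MinimumPrinciple T := by
  intro w hw
  by_contra! hneg
  obtain ⟨k, hk⟩ := hneg
  have : Nonempty ι := ⟨k⟩
  obtain ⟨i, hi⟩ := Finite.exists_min w
  have hclosed := isClosedClass_setOf_eq_min hT.offDiag_nonneg hT.exit_nonneg hw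
    ((hi k).trans_lt hk) hi
  obtain ⟨n, hn⟩ := hT.transient i
  exact hn.ne' (hclosed.jumpMatrix_pow_apply_none n rfl)

lemma MinimumPrinciple.isTransientSubIntensity {T : Matrix ι ι ℝ} (hT : MinimumPrinciple T)
    (ho : ∀ i j, i ≠ j → 0 ≤ T i j) (he : ∀ i, 0 ≤ exitRates T i) :
    IsTransientSubIntensity T where
  diag_neg := hT.diag_neg
  offDiag_nonneg := ho
  exit_nonneg := he
  transient i := by
    by_contra! h
    have hempty := hT.eq_empty_of_isClosedClass (isClosedClass_setOf_not_reach hT.diag_neg ho he)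
    exact Set.notMem_empty i (hempty ▸ h)

lemma mulVec_inv_mulVec_of_isUnit {A : Matrix ι ι ℝ} (hA : IsUnit A) (b : ι → ℝ) :
    A *ᵥ (A⁻¹ *ᵥ b) = b := by
  rw [Matrix.mulVec_mulVec, Matrix.mul_nonsing_inv _ ((Matrix.isUnit_iff_isUnit_det _).1 hA),
    Matrix.one_mulVec]

lemma eq_inv_mulVec_of_isUnit {A : Matrix ι ι ℝ} (hA : IsUnit A) {b v : ι → ℝ}
    (h : A *ᵥ v = b) : v = A⁻¹ *ᵥ b := by
  rw [← h, Matrix.mulVec_mulVec,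
    Matrix.nonsing_inv_mul _ ((Matrix.isUnit_iff_isUnit_det _).1 hA), Matrix.one_mulVec]

lemma MinimumPrinciple.isUnit_diagonal_sub {T : Matrix ι ι ℝ} (hT : MinimumPrinciple T)
    {d : ι → ℝ} (hd : ∀ i, 0 ≤ d i) : IsUnit (Matrix.diagonal d - T) := by
  have hker : ∀ w : ι → ℝ, (Matrix.diagonal d - T) *ᵥ w = 0 → ∀ i, 0 ≤ w i := by
    intro w hw
    refine hT w fun i hi => ?_
    have := congrFun hw i
    rw [Matrix.sub_mulVec, Pi.sub_apply, Matrix.mulVec_diagonal, Pi.zero_apply] at this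
    nlinarith [hd i]
  rw [← Matrix.mulVec_injective_iff_isUnit, ← Matrix.coe_mulVecLin, injective_iff_map_eq_zero]
  intro w hw
  rw [Matrix.mulVecLin_apply] at hw
  ext i
  exact le_antisymm (neg_nonneg.1 (hker (-w) (by rw [Matrix.mulVec_neg, hw, neg_zero]) i))
    (hker w hw i)

lemma MinimumPrinciple.isUnit_smul_one_sub {T : Matrix ι ι ℝ} (hT : MinimumPrinciple T)
    {c : ℝ} (hc : 0 ≤ c) : IsUnit (c • (1 : Matrix ι ι ℝ) - T) := by
  rw [Matrix.smul_one_eq_diagonal]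
  exact hT.isUnit_diagonal_sub fun _ => hc

lemma MinimumPrinciple.isUnit_neg {T : Matrix ι ι ℝ} (hT : MinimumPrinciple T) :
    IsUnit (-T) := by
  simpa using hT.isUnit_smul_one_sub le_rfl

lemma MinimumPrinciple.inv_diagonal_sub_mulVec_nonneg {T : Matrix ι ι ℝ}
    (hT : MinimumPrinciple T) {d b : ι → ℝ} (hd : ∀ i, 0 ≤ d i) (hb : ∀ i, 0 ≤ b i) (i : ι) :
    0 ≤ ((Matrix.diagonal d - T)⁻¹ *ᵥ b) i := by
  refine hT _ (fun j hj => ?_) i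
  have hsolve_j := congrFun (mulVec_inv_mulVec_of_isUnit (hT.isUnit_diagonal_sub hd) b) j
  rw [Matrix.sub_mulVec, Pi.sub_apply, Matrix.mulVec_diagonal] at hsolve_j
  nlinarith [hb j, hd j]

lemma MinimumPrinciple.neg_inv_mulVec_nonneg {T : Matrix ι ι ℝ} (hT : MinimumPrinciple T)
    {b : ι → ℝ} (hb : ∀ i, 0 ≤ b i) (i : ι) : 0 ≤ ((-T)⁻¹ *ᵥ b) i := by
  simpa using hT.inv_diagonal_sub_mulVec_nonneg (d := 0) (fun _ => le_rfl) hb i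

lemma MinimumPrinciple.neg_inv_mul_nonneg {κ : Type*} {T : Matrix ι ι ℝ}
    (hT : MinimumPrinciple T) {B : Matrix ι κ ℝ} (hB : ∀ i j, 0 ≤ B i j) (i : ι) (j : κ) :
    0 ≤ ((-T)⁻¹ * B) i j :=
  hT.neg_inv_mulVec_nonneg (b := fun k => B k j) (fun k => hB k j) i

end MinimumPrinciple

section Blocks

variable {ι : Type*} {r : ι → ℝ}

lemma forall_iff_posPhase_zeroPhase (hr : ∀ i, 0 ≤ r i) {p : ι → Prop} :
    (∀ i, p i) ↔ (∀ i : PosPhase r, p i) ∧ ∀ i : ZeroPhase r, p i := by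
  refine ⟨fun h => ⟨fun i => h i, fun i => h i⟩, fun ⟨hpos, hzero⟩ i => ?_⟩
  rcases (hr i).lt_or_eq with h | h
  · exact hpos ⟨i, h⟩
  · exact hzero ⟨i, h.symm⟩

lemma PosPhase.coe_ne_zeroPhase (i : PosPhase r) (j : ZeroPhase r) : (i : ι) ≠ j :=
  fun h => i.2.ne' (h ▸ j.2)

/-- The vector on all phases with blocks `v` on `E_+` and `w` on `E_0`; it is put to `0` at phases
with negative reward, of which there are none in the intended use. -/
noncomputable def joinPhases (r : ι → ℝ) (v : PosPhase r → ℝ) (w : ZeroPhase r → ℝ) (i : ι) : ℝ :=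
  if h : 0 < r i then v ⟨i, h⟩ else if h' : r i = 0 then w ⟨i, h'⟩ else 0

@[simp]
lemma joinPhases_posPhase (v : PosPhase r → ℝ) (w : ZeroPhase r → ℝ) (i : PosPhase r) :
    joinPhases r v w i = v i := by
  simp [joinPhases, i.2]

@[simp]
lemma joinPhases_zeroPhase (v : PosPhase r → ℝ) (w : ZeroPhase r → ℝ) (i : ZeroPhase r) :
    joinPhases r v w i = w i := by
  simp [joinPhases, i.2]

variable [Fintype ι] {T : Matrix ι ι ℝ}

lemma sum_eq_sum_posPhase_add_sum_zeroPhase (hr : ∀ i, 0 ≤ r i) (f : ι → ℝ) :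
    ∑ i, f i = ∑ i : PosPhase r, f i + ∑ i : ZeroPhase r, f i := by
  rw [← Fintype.sum_subtype_add_sum_subtype (fun i => 0 < r i) f]
  congr 1
  refine Fintype.sum_equiv (Equiv.subtypeEquivRight fun i => ?_) _ _ fun i => rfl
  rw [not_lt, (hr i).ge_iff_eq']

lemma dotProduct_eq_posPhase_add_zeroPhase (hr : ∀ i, 0 ≤ r i) (v w : ι → ℝ) :
    v ⬝ᵥ w = (fun i : PosPhase r => v i) ⬝ᵥ (fun i : PosPhase r => w i) +
      (fun i : ZeroPhase r => v i) ⬝ᵥ (fun i : ZeroPhase r => w i) :=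
  sum_eq_sum_posPhase_add_sum_zeroPhase hr _

lemma mulVec_posPhase (hr : ∀ i, 0 ≤ r i) (T : Matrix ι ι ℝ) (w : ι → ℝ) :
    (fun i : PosPhase r => (T *ᵥ w) i) =
      blockPP r T *ᵥ (fun j => w j) + blockPZ r T *ᵥ fun j => w j :=
  funext fun _ => dotProduct_eq_posPhase_add_zeroPhase hr _ _

lemma mulVec_zeroPhase (hr : ∀ i, 0 ≤ r i) (T : Matrix ι ι ℝ) (w : ι → ℝ) :
    (fun i : ZeroPhase r => (T *ᵥ w) i) =
      blockZP r T *ᵥ (fun j => w j) + blockZZ r T *ᵥ fun j => w j :=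
  funext fun _ => dotProduct_eq_posPhase_add_zeroPhase hr _ _

lemma MinimumPrinciple.nonneg_of_posPhase_zeroPhase (hT : MinimumPrinciple T)
    (hr : ∀ i, 0 ≤ r i) {v : PosPhase r → ℝ} {w : ZeroPhase r → ℝ}
    (hv : ∀ i, v i < 0 → (blockPP r T *ᵥ v + blockPZ r T *ᵥ w) i ≤ 0)
    (hw : ∀ i, w i < 0 → (blockZP r T *ᵥ v + blockZZ r T *ᵥ w) i ≤ 0) :
    (∀ i, 0 ≤ v i) ∧ ∀ i, 0 ≤ w i := by
  have hpos := mulVec_posPhase hr T (joinPhases r v w)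
  have hzero := mulVec_zeroPhase hr T (joinPhases r v w)
  simp only [joinPhases_posPhase, joinPhases_zeroPhase] at hpos hzero
  rw [← hpos] at hv
  rw [← hzero] at hw
  simpa using (forall_iff_posPhase_zeroPhase hr).1 <| hT (joinPhases r v w) <|
    (forall_iff_posPhase_zeroPhase hr).2 ⟨by simpa using hv, by simpa using hw⟩

lemma minimumPrinciple_blockZZ (hr : ∀ i, 0 ≤ r i) (hT : MinimumPrinciple T) :
    MinimumPrinciple (blockZZ r T) := fun w hw =>
  (hT.nonneg_of_posPhase_zeroPhase hr (v := 0) (w := w) (by simp) (by simpa using hw)).2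

variable [DecidableEq ι]

lemma isUnit_neg_blockZZ (hr : ∀ i, 0 ≤ r i) (hT : MinimumPrinciple T) :
    IsUnit (-blockZZ r T) :=
  (minimumPrinciple_blockZZ hr hT).isUnit_neg

/-- The Schur complement of the block `T_{00}`. -/
noncomputable def schurComplement (r : ι → ℝ) (T : Matrix ι ι ℝ) :
    Matrix (PosPhase r) (PosPhase r) ℝ :=
  blockPP r T + blockPZ r T * (-blockZZ r T)⁻¹ * blockZP r T

lemma schurComplement_mulVec (v : PosPhase r → ℝ) :
    schurComplement r T *ᵥ v = blockPP r T *ᵥ v +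
      blockPZ r T *ᵥ ((-blockZZ r T)⁻¹ *ᵥ (blockZP r T *ᵥ v)) := by
  rw [schurComplement, Matrix.add_mulVec, Matrix.mul_assoc, ← Matrix.mulVec_mulVec,
    ← Matrix.mulVec_mulVec]

lemma minimumPrinciple_schurComplement (hr : ∀ i, 0 ≤ r i) (hT : MinimumPrinciple T) :
    MinimumPrinciple (schurComplement r T) := by
  intro v hv
  have hsolve := mulVec_inv_mulVec_of_isUnit (isUnit_neg_blockZZ hr hT) (blockZP r T *ᵥ v)
  rw [Matrix.neg_mulVec] at hsolve
  refine (hT.nonneg_of_posPhase_zeroPhase hr (v := v)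
    (w := (-blockZZ r T)⁻¹ *ᵥ (blockZP r T *ᵥ v)) ?_ fun i _ => ?_).1
  · rwa [← schurComplement_mulVec]
  · have hsolve_i := congrFun hsolve i
    rw [Pi.neg_apply] at hsolve_i
    rw [Pi.add_apply]
    linarith

/-- The vector of the probabilities to be absorbed from the phases in `E_0` without visiting
`E_+`. -/
noncomputable def zeroPhaseExit (r : ι → ℝ) (T : Matrix ι ι ℝ) : ZeroPhase r → ℝ :=
  (-blockZZ r T)⁻¹ *ᵥ fun i => exitRates T i

lemma neg_inv_blockZZ_mulVec_blockZP_mulVec (hr : ∀ i, 0 ≤ r i) (hT : MinimumPrinciple T)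
    {v : ι → ℝ} (hv : ∀ i, r i = 0 → -(T *ᵥ v) i = exitRates T i) :
    (-blockZZ r T)⁻¹ *ᵥ (blockZP r T *ᵥ fun i => v i) =
      (fun i : ZeroPhase r => v i) - zeroPhaseExit r T := by
  have hexit : (fun i : ZeroPhase r => exitRates T i) = -fun i : ZeroPhase r => (T *ᵥ v) i :=
    funext fun i => (hv i i.2).symm
  have hblock : blockZP r T *ᵥ (fun i => v i) =
      -blockZZ r T *ᵥ (fun i => v i) - fun i : ZeroPhase r => exitRates T i := by
    rw [hexit, mulVec_zeroPhase hr, Matrix.neg_mulVec]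
    abel
  rw [hblock, Matrix.mulVec_sub, ← eq_inv_mulVec_of_isUnit (isUnit_neg_blockZZ hr hT) rfl,
    zeroPhaseExit]

lemma schurComplement_mulVec_posPhase (hr : ∀ i, 0 ≤ r i) (hT : MinimumPrinciple T)
    {v : ι → ℝ} (hv : ∀ i, r i = 0 → -(T *ᵥ v) i = exitRates T i) :
    (schurComplement r T *ᵥ fun i => v i) =
      (fun i : PosPhase r => (T *ᵥ v) i) - blockPZ r T *ᵥ zeroPhaseExit r T := by
  rw [schurComplement_mulVec, neg_inv_blockZZ_mulVec_blockZP_mulVec hr hT hv,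
    mulVec_posPhase hr, Matrix.mulVec_sub]
  abel

lemma rewardSubIntensity_eq_diagonal_mul (a : ℝ) :
    rewardSubIntensity a T r =
      Matrix.diagonal (fun i : PosPhase r => (r i ^ a)⁻¹) * schurComplement r T := by
  rw [rewardSubIntensity, schurComplement]
  congr 1
  refine Matrix.inv_eq_right_inv ?_
  rw [Matrix.diagonal_mul_diagonal, ← Matrix.diagonal_one]
  congr 1
  ext i
  exact mul_inv_cancel₀ (Real.rpow_pos_of_pos i.2 a).ne'

lemma rewardSubIntensity_mulVec (a : ℝ) (v : PosPhase r → ℝ) (i : PosPhase r) :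
    (rewardSubIntensity a T r *ᵥ v) i = (r i ^ a)⁻¹ * (schurComplement r T *ᵥ v) i := by
  rw [rewardSubIntensity_eq_diagonal_mul, ← Matrix.mulVec_mulVec, Matrix.mulVec_diagonal]

lemma minimumPrinciple_rewardSubIntensity (hr : ∀ i, 0 ≤ r i) (hT : MinimumPrinciple T)
    (a : ℝ) : MinimumPrinciple (rewardSubIntensity a T r) := by
  refine fun v hv => minimumPrinciple_schurComplement hr hT v fun i hi => ?_
  have hscaled := hv i hi
  rw [rewardSubIntensity_mulVec] at hscaled
  exact nonpos_of_mul_nonpos_right hscaled (inv_pos.2 (Real.rpow_pos_of_pos i.2 a))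

lemma exitRates_rewardSubIntensity (hr : ∀ i, 0 ≤ r i) (hT : MinimumPrinciple T) (a : ℝ)
    (i : PosPhase r) :
    exitRates (rewardSubIntensity a T r) i =
      (r i ^ a)⁻¹ * (exitRates T i + (blockPZ r T *ᵥ zeroPhaseExit r T) i) := by
  have hone : (schurComplement r T *ᵥ 1) i = (T *ᵥ 1) i - (blockPZ r T *ᵥ zeroPhaseExit r T) i :=
    congrFun (schurComplement_mulVec_posPhase hr hT (v := 1) fun _ _ => rfl) i
  rw [exitRates, Pi.neg_apply, rewardSubIntensity_mulVec, hone, exitRates, Pi.neg_apply]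
  ring

lemma blockPZ_nonneg (hT : IsTransientSubIntensity T) (i : PosPhase r) (j : ZeroPhase r) :
    0 ≤ blockPZ r T i j :=
  hT.offDiag_nonneg _ _ (i.coe_ne_zeroPhase j)

lemma neg_inv_blockZZ_mul_blockZP_nonneg (hr : ∀ i, 0 ≤ r i) (hT : IsTransientSubIntensity T)
    (i : ZeroPhase r) (j : PosPhase r) : 0 ≤ ((-blockZZ r T)⁻¹ * blockZP r T) i j :=
  (minimumPrinciple_blockZZ hr hT.minimumPrinciple).neg_inv_mul_nonneg
    (fun k l => hT.offDiag_nonneg _ _ (l.coe_ne_zeroPhase k).symm) i j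

lemma zeroPhaseExit_nonneg (hr : ∀ i, 0 ≤ r i) (hT : IsTransientSubIntensity T)
    (i : ZeroPhase r) : 0 ≤ zeroPhaseExit r T i :=
  (minimumPrinciple_blockZZ hr hT.minimumPrinciple).neg_inv_mulVec_nonneg
    (fun j => hT.exit_nonneg j) i

lemma isTransientSubIntensity_rewardSubIntensity (hr : ∀ i, 0 ≤ r i)
    (hT : IsTransientSubIntensity T) (a : ℝ) :
    IsTransientSubIntensity (rewardSubIntensity a T r) := by
  have hscale : ∀ i, 0 ≤ (r i ^ a)⁻¹ := fun i => inv_nonneg.2 (Real.rpow_nonneg (hr i) a)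
  refine (minimumPrinciple_rewardSubIntensity hr hT.minimumPrinciple a).isTransientSubIntensity
    (fun i j hij => ?_) fun i => ?_
  · rw [rewardSubIntensity_eq_diagonal_mul, Matrix.diagonal_mul, schurComplement,
      Matrix.mul_assoc, Matrix.add_apply, Matrix.mul_apply]
    refine mul_nonneg (hscale i) (add_nonneg (hT.offDiag_nonneg _ _ (Subtype.coe_injective.ne hij))
      (Finset.sum_nonneg fun k _ => ?_))
    exact mul_nonneg (blockPZ_nonneg hT i k) (neg_inv_blockZZ_mul_blockZP_nonneg hr hT k j)
  · rw [exitRates_rewardSubIntensity hr hT.minimumPrinciple]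
    refine mul_nonneg (hscale i) (add_nonneg (hT.exit_nonneg _) (Finset.sum_nonneg fun k _ => ?_))
    exact mul_nonneg (blockPZ_nonneg hT i k) (zeroPhaseExit_nonneg hr hT k)

lemma rewardInit_nonneg (hr : ∀ i, 0 ≤ r i) (hT : IsTransientSubIntensity T) {π : ι → ℝ}
    (hπ : ∀ i, 0 ≤ π i) (i : PosPhase r) : 0 ≤ rewardInit π T r i :=
  add_nonneg (hπ i) (Finset.sum_nonneg fun k _ => mul_nonneg (hπ k)
    (neg_inv_blockZZ_mul_blockZP_nonneg hr hT k i))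

lemma rewardInit_dotProduct_posPhase (hr : ∀ i, 0 ≤ r i) (hT : MinimumPrinciple T) (π : ι → ℝ)
    {v : ι → ℝ} (hv : ∀ i, r i = 0 → -(T *ᵥ v) i = exitRates T i) :
    rewardInit π T r ⬝ᵥ (fun i => v i) =
      π ⬝ᵥ v - (fun i : ZeroPhase r => π i) ⬝ᵥ zeroPhaseExit r T := by
  rw [rewardInit, add_dotProduct, ← Matrix.dotProduct_mulVec, ← Matrix.mulVec_mulVec,
    neg_inv_blockZZ_mulVec_blockZP_mulVec hr hT hv, dotProduct_sub,
    dotProduct_eq_posPhase_add_zeroPhase hr π v]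
  ring

lemma sum_rewardInit (hr : ∀ i, 0 ≤ r i) (hT : MinimumPrinciple T) (π : ι → ℝ) :
    ∑ i, rewardInit π T r i =
      ∑ i, π i - (fun i : ZeroPhase r => π i) ⬝ᵥ zeroPhaseExit r T := by
  simpa only [Pi.one_apply, dotProduct, mul_one] using
    rewardInit_dotProduct_posPhase hr hT π (v := 1) fun _ _ => rfl

lemma sum_rewardInit_le (hr : ∀ i, 0 ≤ r i) (hT : IsTransientSubIntensity T) {π : ι → ℝ}
    (hπ : ∀ i, 0 ≤ π i) : ∑ i, rewardInit π T r i ≤ ∑ i, π i := by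
  rw [sum_rewardInit hr hT.minimumPrinciple, sub_le_self_iff]
  exact Finset.sum_nonneg fun i _ => mul_nonneg (hπ i) (zeroPhaseExit_nonneg hr hT i)

lemma dotProduct_eq_rewardInit_dotProduct_add (hr : ∀ i, 0 ≤ r i) (hT : MinimumPrinciple T)
    (π : ι → ℝ) {v : ι → ℝ} (hv : ∀ i, r i = 0 → -(T *ᵥ v) i = exitRates T i) :
    π ⬝ᵥ v = rewardInit π T r ⬝ᵥ (fun i => v i) + (∑ i, π i - ∑ i, rewardInit π T r i) := by
  rw [rewardInit_dotProduct_posPhase hr hT π hv, sum_rewardInit hr hT]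
  ring

lemma posPhase_eq_resolvent_mulVec_exitRates (hr : ∀ i, 0 ≤ r i) (hT : MinimumPrinciple T)
    {a u : ℝ} (ha : a ≠ 0) (hu : 0 ≤ u) {v : ι → ℝ}
    (hv : ∀ i, (u * r i) ^ a * v i - (T *ᵥ v) i = exitRates T i) :
    (fun i : PosPhase r => v i) =
      ((u ^ a) • (1 : Matrix (PosPhase r) (PosPhase r) ℝ) - rewardSubIntensity a T r)⁻¹ *ᵥ
        exitRates (rewardSubIntensity a T r) := by
  have hzero : ∀ i, r i = 0 → -(T *ᵥ v) i = exitRates T i := by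
    intro i hi
    rw [← hv i, hi, mul_zero, Real.zero_rpow ha, zero_mul, zero_sub]
  have hunit := (minimumPrinciple_rewardSubIntensity hr hT a).isUnit_smul_one_sub
    (Real.rpow_nonneg hu a)
  refine eq_inv_mulVec_of_isUnit hunit (funext fun i => ?_)
  have hscale := (Real.rpow_pos_of_pos i.2 a).ne'
  rw [exitRates_rewardSubIntensity hr hT, Matrix.sub_mulVec, Pi.sub_apply,
    rewardSubIntensity_mulVec, schurComplement_mulVec_posPhase hr hT hzero,
    Matrix.smul_mulVec, Matrix.one_mulVec, ← hv i, Real.mul_rpow hu (hr i)]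
  simp only [Pi.smul_apply, smul_eq_mul, Pi.sub_apply]
  field_simp
  ring

end Blocks

section AlternatingDifferences

/-- `φ` is alternating of order `n` if `(-1) ^ k Δ ^ k φ ≥ 0` on `(0, ∞)` for all `k ≤ n`, where `Δ`
is the forward difference with step `1`. Functions that are alternating of every order stand in for
the completely monotone functions. -/
def IsAlternating : ℕ → (ℝ → ℝ) → Prop
  | 0, φ => ∀ x > 0, 0 ≤ φ x
  | n + 1, φ => (∀ x > 0, 0 ≤ φ x) ∧ IsAlternating n fun x => φ x - φ (x + 1)

lemma sub_add_one_nonneg_of_hasDerivAt {φ φ' : ℝ → ℝ} (hφ : ∀ x > 0, HasDerivAt φ (φ' x) x)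
    (hφ' : ∀ x > 0, 0 ≤ -φ' x) {x : ℝ} (hx : 0 < x) : 0 ≤ φ x - φ (x + 1) := by
  refine sub_nonneg.2 (antitoneOn_of_hasDerivWithinAt_nonpos (convex_Ioi (0 : ℝ))
    (fun z hz => (hφ z hz).continuousAt.continuousWithinAt)
    (fun z hz => (hφ z (interior_subset hz)).hasDerivWithinAt)
    (fun z hz => neg_nonneg.1 (hφ' z (interior_subset hz))) hx (add_pos hx one_pos) ?_)
  linarith

namespace IsAlternating

variable {n : ℕ} {φ ψ : ℝ → ℝ}

lemma nonneg (hφ : IsAlternating n φ) {x : ℝ} (hx : 0 < x) : 0 ≤ φ x := by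
  cases n with
  | zero => exact hφ x hx
  | succ n => exact hφ.1 x hx

lemma congr (hφ : IsAlternating n φ) (h : ∀ x > 0, φ x = ψ x) : IsAlternating n ψ := by
  induction n generalizing φ ψ with
  | zero => exact fun x hx => h x hx ▸ hφ x hx
  | succ n ih =>
    refine ⟨fun x hx => h x hx ▸ hφ.1 x hx, ih hφ.2 fun x hx => ?_⟩
    rw [h x hx, h (x + 1) (by linarith)]

lemma of_succ (hφ : IsAlternating (n + 1) φ) : IsAlternating n φ := by
  induction n generalizing φ with
  | zero => exact hφ.1
  | succ n ih => exact ⟨hφ.1, ih hφ.2⟩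

lemma add (hφ : IsAlternating n φ) (hψ : IsAlternating n ψ) :
    IsAlternating n fun x => φ x + ψ x := by
  induction n generalizing φ ψ with
  | zero => exact fun x hx => add_nonneg (hφ x hx) (hψ x hx)
  | succ n ih =>
    refine ⟨fun x hx => add_nonneg (hφ.1 x hx) (hψ.1 x hx), (ih hφ.2 hψ.2).congr fun x _ => ?_⟩
    ring

lemma const_mul (hφ : IsAlternating n φ) {c : ℝ} (hc : 0 ≤ c) :
    IsAlternating n fun x => c * φ x := by
  induction n generalizing φ with
  | zero => exact fun x hx => mul_nonneg hc (hφ x hx)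
  | succ n ih =>
    refine ⟨fun x hx => mul_nonneg hc (hφ.1 x hx), (ih hφ.2).congr fun x _ => ?_⟩
    ring

lemma comp_add_one (hφ : IsAlternating n φ) : IsAlternating n fun x => φ (x + 1) := by
  induction n generalizing φ with
  | zero => exact fun x hx => hφ (x + 1) (by linarith)
  | succ n ih => exact ⟨fun x hx => hφ.1 (x + 1) (by linarith), ih hφ.2⟩

lemma mul (hφ : IsAlternating n φ) (hψ : IsAlternating n ψ) :
    IsAlternating n fun x => φ x * ψ x := by
  induction n generalizing φ ψ with
  | zero => exact fun x hx => mul_nonneg (hφ x hx) (hψ x hx)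
  | succ n ih =>
    refine ⟨fun x hx => mul_nonneg (hφ.1 x hx) (hψ.1 x hx), ?_⟩
    refine ((ih hφ.2 hψ.of_succ).add (ih hφ.of_succ.comp_add_one hψ.2)).congr fun x _ => ?_
    ring

lemma inv (hφ : ∀ x > 0, 0 < φ x) (hφ' : ∀ n, IsAlternating n fun x => φ (x + 1) - φ x) (n : ℕ) :
    IsAlternating n fun x => (φ x)⁻¹ := by
  induction n with
  | zero => exact fun x hx => inv_nonneg.2 (hφ x hx).le
  | succ n ih =>
    refine ⟨fun x hx => inv_nonneg.2 (hφ x hx).le, ?_⟩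
    refine ((ih.mul ih.comp_add_one).mul (hφ' n)).congr fun x hx => ?_
    have hx0 := (hφ x hx).ne'
    have hx1 := (hφ (x + 1) (by linarith)).ne'
    field_simp

lemma sub_comp_add_one_of_hasDerivAt {φ' : ℝ → ℝ} (hφ : ∀ x > 0, HasDerivAt φ (φ' x) x)
    (hφ' : IsAlternating n fun x => -φ' x) : IsAlternating n fun x => φ x - φ (x + 1) := by
  induction n generalizing φ φ' with
  | zero => exact fun x hx => sub_add_one_nonneg_of_hasDerivAt hφ (fun y hy => hφ'.nonneg hy) hx
  | succ n ih =>
    refine ⟨fun x hx => sub_add_one_nonneg_of_hasDerivAt hφ (fun y hy => hφ'.nonneg hy) hx,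
      ih (fun x hx => (hφ x hx).sub ((hφ (x + 1) (by linarith)).comp_add_const x 1)) ?_⟩
    exact hφ'.2.congr fun x _ => by ring

end IsAlternating

lemma isAlternating_rpow_of_nonpos {b : ℝ} (hb : b ≤ 0) (n : ℕ) :
    IsAlternating n fun x => x ^ b := by
  induction n generalizing b with
  | zero => exact fun x hx => Real.rpow_nonneg hx.le b
  | succ n ih =>
    refine ⟨fun x hx => Real.rpow_nonneg hx.le b, IsAlternating.sub_comp_add_one_of_hasDerivAt
      (fun x hx => Real.hasDerivAt_rpow_const (Or.inl hx.ne')) ?_⟩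
    exact ((ih (by linarith : b - 1 ≤ 0)).const_mul (neg_nonneg.2 hb)).congr fun x _ => by ring

lemma isAlternating_rpow_add_one_sub_rpow {a : ℝ} (ha0 : 0 ≤ a) (ha1 : a ≤ 1) (n : ℕ) :
    IsAlternating n fun x => (x + 1) ^ a - x ^ a := by
  refine (IsAlternating.sub_comp_add_one_of_hasDerivAt (φ := fun x => -x ^ a)
    (fun x hx => (Real.hasDerivAt_rpow_const (Or.inl hx.ne')).neg) ?_).congr fun x _ => by ring
  exact ((isAlternating_rpow_of_nonpos (by linarith : a - 1 ≤ 0) n).const_mul ha0).congr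
    fun x _ => by ring

lemma isAlternating_div_add_rpow {a l : ℝ} (ha0 : 0 ≤ a) (ha1 : a ≤ 1) (hl : 0 < l) (n : ℕ) :
    IsAlternating n fun x => l / (l + x ^ a) := by
  refine ((IsAlternating.inv (φ := fun x => l + x ^ a)
    (fun x hx => add_pos_of_pos_of_nonneg hl (Real.rpow_nonneg hx.le a)) (fun m => ?_) n).const_mul
    hl.le).congr fun x _ => (div_eq_mul_inv _ _).symm
  exact (isAlternating_rpow_add_one_sub_rpow ha0 ha1 m).congr fun x _ => by ring

end AlternatingDifferences

section Positivity

open Filter Topology unitInterval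
open scoped BoundedContinuousFunction NNReal

variable {X : Type*} [MeasurableSpace X]

lemma measure_le_of_forall_lintegral_le [TopologicalSpace X]
    [TopologicalSpace.PseudoMetrizableSpace X] [BorelSpace X] (μ ν : Measure X)
    [IsFiniteMeasure μ] [IsFiniteMeasure ν] (h : ∀ f : X →ᵇ ℝ≥0, ∫⁻ x, f x ∂μ ≤ ∫⁻ x, f x ∂ν) :
    μ ≤ ν := by
  have hclosed : ∀ F : Set X, IsClosed F → μ F ≤ ν F := fun F hF =>
    le_of_tendsto_of_tendsto' (HasOuterApproxClosed.tendsto_lintegral_apprSeq hF μ)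
      (HasOuterApproxClosed.tendsto_lintegral_apprSeq hF ν)
      fun n => h (hF.apprSeq n)
  refine Measure.le_iff.2 fun B hB => ?_
  rw [hB.measure_eq_iSup_isClosed_of_ne_top (measure_ne_top _ _)]
  exact iSup₂_le fun F hFB => iSup_le fun hF => (hclosed F hF).trans (measure_mono hFB)

variable {ρ : Measure X} {w : X → ℝ}

lemma integral_withDensity_ofReal (hw : AEMeasurable w ρ) (g : X → ℝ) :
    ∫ x, g x ∂ρ.withDensity (fun x => ENNReal.ofReal (w x)) = ∫ x, max (w x) 0 * g x ∂ρ := by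
  simp only [integral_withDensity_eq_integral_toReal_smul₀ hw.ennreal_ofReal
    (ae_of_all _ fun _ => ENNReal.ofReal_lt_top), ENNReal.toReal_ofReal', smul_eq_mul]

lemma integrable_comp_mul {φ : X → I} (hφ : Measurable φ) (hw : Integrable w ρ) (f : C(I, ℝ)) :
    Integrable (fun x => f (φ x) * w x) ρ :=
  hw.bdd_mul (c := ‖f‖) (f.continuous.measurable.comp hφ).aestronglyMeasurable
    (ae_of_all _ fun _ => f.norm_coe_le_norm _)

lemma integral_bernsteinApproximation_mul_nonneg (hw : Integrable w ρ) {φ : X → I}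
    (hφ : Measurable φ)
    (h : ∀ k m : ℕ, 0 ≤ ∫ x, (φ x : ℝ) ^ k * (1 - (φ x : ℝ)) ^ m * w x ∂ρ)
    {g : C(I, ℝ)} (hg : ∀ y, 0 ≤ g y) (n : ℕ) :
    0 ≤ ∫ x, bernsteinApproximation n g (φ x) * w x ∂ρ := by
  have hexpand : ∀ x, bernsteinApproximation n g (φ x) * w x = ∑ k : Fin (n + 1),
      (n.choose k * g (bernstein.z k)) *
        ((φ x : ℝ) ^ (k : ℕ) * (1 - (φ x : ℝ)) ^ (n - k) * w x) := by
    intro x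
    rw [bernsteinApproximation.apply, Finset.sum_mul]
    refine Finset.sum_congr rfl fun k _ => ?_
    rw [bernstein_apply, smul_eq_mul]
    ring
  simp_rw [hexpand]
  rw [integral_finsetSum]
  · refine Finset.sum_nonneg fun k _ => ?_
    rw [integral_const_mul]
    exact mul_nonneg (mul_nonneg (Nat.cast_nonneg _) (hg _)) (h _ _)
  · exact fun k _ => (integrable_comp_mul hφ hw
      ⟨fun y => (y : ℝ) ^ (k : ℕ) * (1 - (y : ℝ)) ^ (n - (k : ℕ)), by fun_prop⟩).const_mul _

lemma integral_comp_mul_nonneg_of_moments (hw : Integrable w ρ) {φ : X → I} (hφ : Measurable φ)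
    (h : ∀ k m : ℕ, 0 ≤ ∫ x, (φ x : ℝ) ^ k * (1 - (φ x : ℝ)) ^ m * w x ∂ρ)
    {g : C(I, ℝ)} (hg : ∀ y, 0 ≤ g y) : 0 ≤ ∫ x, g (φ x) * w x ∂ρ := by
  have hlim := bernsteinApproximation_uniform g
  obtain ⟨C, hC⟩ := hlim.norm.bddAbove_range
  refine ge_of_tendsto' (f := fun n => ∫ x, bernsteinApproximation n g (φ x) * w x ∂ρ)
    (x := atTop) ?_ (integral_bernsteinApproximation_mul_nonneg hw hφ h hg)
  refine tendsto_integral_of_dominated_convergence (fun x => C * ‖w x‖)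
    (fun n => (integrable_comp_mul hφ hw _).aestronglyMeasurable) (hw.norm.const_mul C)
    (fun n => ae_of_all _ fun x => ?_) (ae_of_all _ fun x => ?_)
  · rw [norm_mul]
    exact mul_le_mul_of_nonneg_right
      (((bernsteinApproximation n g).norm_coe_le_norm _).trans (hC ⟨n, rfl⟩)) (norm_nonneg _)
  · exact (((continuous_eval_const (φ x)).tendsto g).comp hlim).mul_const _

lemma map_withDensity_neg_le_of_moments (hw : Integrable w ρ) {φ : X → I} (hφ : Measurable φ)
    (h : ∀ k m : ℕ, 0 ≤ ∫ x, (φ x : ℝ) ^ k * (1 - (φ x : ℝ)) ^ m * w x ∂ρ) :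
    (ρ.withDensity fun x => ENNReal.ofReal (-w x)).map φ ≤
      (ρ.withDensity fun x => ENNReal.ofReal (w x)).map φ := by
  have hneg := isFiniteMeasure_withDensity_ofReal hw.neg.2
  have hpos := isFiniteMeasure_withDensity_ofReal hw.2
  refine measure_le_of_forall_lintegral_le _ _ fun f => ?_
  rw [← ENNReal.toReal_le_toReal (f.lintegral_lt_top_of_nnreal _).ne
    (f.lintegral_lt_top_of_nnreal _).ne, f.toReal_lintegral_coe_eq_integral,
    f.toReal_lintegral_coe_eq_integral]
  let g : C(I, ℝ) := ⟨fun y => f y, by fun_prop⟩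
  change ∫ y, g y ∂_ ≤ ∫ y, g y ∂_
  rw [integral_map hφ.aemeasurable (map_continuous g).aestronglyMeasurable,
    integral_map hφ.aemeasurable (map_continuous g).aestronglyMeasurable,
    integral_withDensity_ofReal (w := fun x => -w x) hw.1.aemeasurable.neg,
    integral_withDensity_ofReal hw.1.aemeasurable, ← sub_nonneg, ← integral_sub]
  · refine (integral_comp_mul_nonneg_of_moments hw hφ h (g := g) fun y => (f y).2).trans_eq
      (integral_congr_ae (ae_of_all _ fun x => ?_))
    change (f (φ x) : ℝ) * w x = max (w x) 0 * f (φ x) - max (-w x) 0 * f (φ x)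
    rw [← sub_mul, max_zero_sub_max_neg_zero_eq_self, mul_comm]
  · simpa only [mul_comm] using integrable_comp_mul hφ hw.pos_part g
  · simpa only [mul_comm] using integrable_comp_mul hφ hw.neg_part g

lemma ae_nonneg_of_withDensity_neg_le (hw : Integrable w ρ)
    (h : (ρ.withDensity fun x => ENNReal.ofReal (-w x)) ≤
      ρ.withDensity fun x => ENNReal.ofReal (w x)) : ∀ᵐ x ∂ρ, 0 ≤ w x := by
  refine ae_nonneg_of_forall_setIntegral_nonneg hw fun s hs _ => ?_
  rw [integral_eq_lintegral_pos_part_sub_lintegral_neg_part hw.restrict, sub_nonneg]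
  have hs' := h s
  rw [withDensity_apply _ hs, withDensity_apply _ hs] at hs'
  exact ENNReal.toReal_mono hw.restrict.lintegral_lt_top.ne hs'

lemma ae_nonneg_of_moments (hw : Integrable w ρ) {φ : X → I} (hφ : Measurable φ) {ψ : I → X}
    (hψ : Measurable ψ) (hψφ : ∀ᵐ x ∂ρ, ψ (φ x) = x)
    (h : ∀ k m : ℕ, 0 ≤ ∫ x, (φ x : ℝ) ^ k * (1 - (φ x : ℝ)) ^ m * w x ∂ρ) :
    ∀ᵐ x ∂ρ, 0 ≤ w x := by
  have hinverse : ∀ κ : Measure X, κ ≪ ρ → (κ.map φ).map ψ = κ := by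
    intro κ hκ
    rw [Measure.map_map hψ hφ]
    exact (Measure.map_congr (hκ.ae_le hψφ)).trans Measure.map_id
  apply ae_nonneg_of_withDensity_neg_le hw
  rw [← hinverse _ (withDensity_absolutelyContinuous _ fun x => ENNReal.ofReal (-w x)),
    ← hinverse _ (withDensity_absolutelyContinuous _ fun x => ENNReal.ofReal (w x))]
  exact Measure.map_mono (map_withDensity_neg_le_of_moments hw hφ h) hψ

lemma integral_one_sub_exp_pow_mul_nonneg {ρ : Measure ℝ} {w F : ℝ → ℝ} {c : ℝ} (hc : 0 ≤ c)
    (hint : ∀ u > c, Integrable (fun x => Real.exp (-(u * x)) * w x) ρ)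
    (hlaplace : ∀ u > c, ∫ x, Real.exp (-(u * x)) * w x ∂ρ = F u) {n : ℕ}
    (hF : IsAlternating n F) {u : ℝ} (hu : c < u) :
    0 ≤ ∫ x, (1 - Real.exp (-x)) ^ n * (Real.exp (-(u * x)) * w x) ∂ρ := by
  induction n generalizing w F u with
  | zero =>
    simp only [pow_zero, one_mul]
    rw [hlaplace u hu]
    exact hF u (hc.trans_lt hu)
  | succ n ih =>
    have hdecr : ∀ u x, Real.exp (-(u * x)) * ((1 - Real.exp (-x)) * w x) =
        Real.exp (-(u * x)) * w x - Real.exp (-((u + 1) * x)) * w x := by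
      intro u x
      rw [show -((u + 1) * x) = -(u * x) + -x by ring, Real.exp_add]
      ring
    have hshift : ∀ u > c, c < u + 1 := fun u hu => by linarith
    refine (ih (w := fun x => (1 - Real.exp (-x)) * w x) (fun u hu => ?_) (fun u hu => ?_) hF.2
      hu).trans_eq (integral_congr_ae (ae_of_all _ fun x => by ring))
    · simp_rw [hdecr]
      exact (hint u hu).sub (hint (u + 1) (hshift u hu))
    · simp_rw [hdecr]
      rw [integral_sub (hint u hu) (hint (u + 1) (hshift u hu)), hlaplace u hu,
        hlaplace (u + 1) (hshift u hu)]

theorem ae_nonneg_of_laplace_isAlternating {ρ : Measure ℝ} (hρ : ∀ᵐ x ∂ρ, 0 ≤ x) {w F : ℝ → ℝ}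
    {c : ℝ} (hc : 0 ≤ c) (hint : ∀ u > c, Integrable (fun x => Real.exp (-(u * x)) * w x) ρ)
    (hlaplace : ∀ u > c, ∫ x, Real.exp (-(u * x)) * w x ∂ρ = F u)
    (hF : ∀ n, IsAlternating n F) : ∀ᵐ x ∂ρ, 0 ≤ w x := by
  have hproj : ∀ x : ℝ, 0 ≤ x →
      (Set.projIcc (0 : ℝ) 1 zero_le_one (Real.exp (-x)) : ℝ) = Real.exp (-x) := by
    intro x hx
    rw [Set.projIcc_of_mem zero_le_one
      ⟨(Real.exp_pos _).le, Real.exp_le_one_iff.2 (neg_nonpos.2 hx)⟩]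
  have htilt : ∀ᵐ x ∂ρ, 0 ≤ Real.exp (-((c + 1) * x)) * w x := by
    refine ae_nonneg_of_moments
      (φ := fun x => Set.projIcc 0 1 zero_le_one (Real.exp (-x))) (ψ := fun y => -Real.log y)
      (hint _ (lt_add_one c)) (continuous_projIcc.measurable.comp (by fun_prop))
      (Real.measurable_log.comp measurable_subtype_coe).neg ?_ fun k m => ?_
    · filter_upwards [hρ] with x hx
      rw [hproj x hx, Real.log_exp, neg_neg]
    · have hk : c < c + 1 + k := by linarith [k.cast_nonneg (α := ℝ)]
      refine (integral_one_sub_exp_pow_mul_nonneg hc hint hlaplace (hF m) hk).trans_eq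
        (integral_congr_ae ?_)
      filter_upwards [hρ] with x hx
      rw [hproj x hx, ← Real.exp_nat_mul,
        show -((c + 1 + k) * x) = k * -x + -((c + 1) * x) by ring, Real.exp_add]
      ring
  filter_upwards [htilt] with x hx
  exact nonneg_of_mul_nonneg_right hx (Real.exp_pos _)

end Positivity

section MittagLefflerLaplace

open Filter Topology Set

/-- The density of `mlMeasure a l` on `(0, ∞)`. -/
noncomputable def mlDensity (a l x : ℝ) : ℝ := l * x ^ (a - 1) * mittagLeffler a a (-l * x ^ a)

lemma measurable_mlDensity (a l : ℝ) : Measurable (mlDensity a l) := by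
  unfold mlDensity mittagLeffler
  exact Measurable.mul (by fun_prop) (Measurable.tsum fun k => by fun_prop)

/-- The terms of the series expansion of `exp (- u x) * mlDensity a l x`. -/
noncomputable def mlTerm (a l u : ℝ) (k : ℕ) (x : ℝ) : ℝ :=
  (-1) ^ k * l ^ (k + 1) / Real.Gamma (a * (k + 1)) *
    (x ^ (a * (k + 1) - 1) * Real.exp (-(u * x)))

lemma exp_mul_mlDensity_eq_tsum (a l u : ℝ) {x : ℝ} (hx : 0 < x) :
    Real.exp (-(u * x)) * mlDensity a l x = ∑' k, mlTerm a l u k x := by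
  rw [mlDensity, mittagLeffler, ← mul_assoc, ← tsum_mul_left]
  refine tsum_congr fun k => ?_
  have hpow : x ^ (a * (k + 1) - 1) = x ^ (a - 1) * (x ^ a) ^ k := by
    rw [← Real.rpow_natCast, ← Real.rpow_mul hx.le, ← Real.rpow_add hx]
    ring_nf
  rw [mlTerm, hpow, mul_add, mul_one, neg_mul, neg_pow, mul_pow, pow_succ]
  ring

lemma integrableOn_rpow_mul_exp_neg_mul {s u : ℝ} (hs : 0 < s) (hu : 0 < u) :
    IntegrableOn (fun x : ℝ => x ^ (s - 1) * Real.exp (-(u * x))) (Ioi 0) := by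
  simpa using integrableOn_rpow_mul_exp_neg_mul_rpow (s := s - 1) (by linarith) one_pos hu

variable {a l u : ℝ}

lemma integrableOn_mlTerm (ha : 0 < a) (hu : 0 < u) (k : ℕ) :
    IntegrableOn (mlTerm a l u k) (Ioi 0) :=
  (integrableOn_rpow_mul_exp_neg_mul (by positivity) hu).const_mul _

lemma integral_mlTerm (ha : 0 < a) (hu : 0 < u) (k : ℕ) :
    ∫ x in Ioi 0, mlTerm a l u k x = l / u ^ a * (-(l / u ^ a)) ^ k := by
  have hs : 0 < a * ((k : ℝ) + 1) := by positivity
  have hGamma := (Real.Gamma_pos_of_pos hs).ne'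
  have hua := (Real.rpow_pos_of_pos hu a).ne'
  have hpow : (1 / u) ^ (a * ((k : ℝ) + 1)) = ((u ^ a) ^ (k + 1))⁻¹ := by
    rw [one_div, Real.inv_rpow hu.le, Real.rpow_mul hu.le, ← Nat.cast_add_one, Real.rpow_natCast]
  unfold mlTerm
  rw [integral_const_mul, Real.integral_rpow_mul_exp_neg_mul_Ioi hs hu, hpow,
    neg_pow (l / u ^ a), div_pow]
  field_simp
  ring

lemma norm_mlTerm (ha : 0 < a) (hl : 0 < l) (k : ℕ) {x : ℝ} (hx : 0 < x) :
    ‖mlTerm a l u k x‖ = (-1) ^ k * mlTerm a l u k x := by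
  have hnonneg : 0 ≤ (-1) ^ k * mlTerm a l u k x := by
    rw [mlTerm, mul_div_assoc, mul_assoc, ← mul_assoc ((-1 : ℝ) ^ k), ← mul_pow, neg_one_mul,
      neg_neg, one_pow, one_mul]
    positivity
  rw [← abs_of_nonneg hnonneg, abs_mul, abs_pow, abs_neg, abs_one, one_pow, one_mul,
    Real.norm_eq_abs]

lemma integral_norm_mlTerm (ha : 0 < a) (hl : 0 < l) (hu : 0 < u) (k : ℕ) :
    ∫ x in Ioi 0, ‖mlTerm a l u k x‖ = l / u ^ a * (l / u ^ a) ^ k := by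
  rw [setIntegral_congr_fun measurableSet_Ioi fun x hx => norm_mlTerm ha hl k hx,
    integral_const_mul, integral_mlTerm ha hu, mul_left_comm, ← mul_pow, neg_one_mul, neg_neg]

lemma summable_integral_norm_mlTerm (ha : 0 < a) (hl : 0 < l) (hu : 0 < u) (hlu : l < u ^ a) :
    Summable fun k => ∫ x in Ioi 0, ‖mlTerm a l u k x‖ := by
  simp_rw [integral_norm_mlTerm ha hl hu]
  refine (summable_geometric_of_lt_one (by positivity) ?_).mul_left _
  rwa [div_lt_one (by positivity)]

lemma integrable_tsum_of_summable_integral_norm {X E : Type*} [MeasurableSpace X]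
    [NormedAddCommGroup E] {μ : Measure X} {F : ℕ → X → E} (hF : ∀ n, Integrable (F n) μ)
    (hsum : Summable fun n => ∫ x, ‖F n x‖ ∂μ)
    (hmeas : AEStronglyMeasurable (fun x => ∑' n, F n x) μ) :
    Integrable (fun x => ∑' n, F n x) μ := by
  refine ⟨hmeas, ?_⟩
  calc ∫⁻ x, ‖∑' n, F n x‖ₑ ∂μ ≤ ∫⁻ x, ∑' n, ‖F n x‖ₑ ∂μ :=
        lintegral_mono fun x => enorm_tsum_le_tsum_enorm
    _ = ∑' n, ∫⁻ x, ‖F n x‖ₑ ∂μ := lintegral_tsum fun n => (hF n).1.enorm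
    _ = ∑' n, ENNReal.ofReal (∫ x, ‖F n x‖ ∂μ) := by
        simp_rw [ofReal_integral_norm_eq_lintegral_enorm (hF _)]
    _ < ∞ := hsum.tsum_ofReal_lt_top

lemma integrableOn_exp_mul_mlDensity (ha : 0 < a) (hl : 0 < l) (hu : 0 < u) (hlu : l < u ^ a) :
    IntegrableOn (fun x => Real.exp (-(u * x)) * mlDensity a l x) (Ioi 0) := by
  refine IntegrableOn.congr_fun (integrable_tsum_of_summable_integral_norm
    (integrableOn_mlTerm ha hu) (summable_integral_norm_mlTerm ha hl hu hlu)
    (Measurable.tsum fun k => ?_).aestronglyMeasurable)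
    (fun x hx => (exp_mul_mlDensity_eq_tsum a l u hx).symm) measurableSet_Ioi
  unfold mlTerm
  fun_prop

lemma integral_exp_mul_mlDensity (ha : 0 < a) (hl : 0 < l) (hu : 0 < u) (hlu : l < u ^ a) :
    ∫ x in Ioi 0, Real.exp (-(u * x)) * mlDensity a l x = l / (l + u ^ a) := by
  have hua : 0 < u ^ a := by positivity
  have hratio : |-(l / u ^ a)| < 1 := by
    rwa [abs_neg, abs_of_pos (by positivity), div_lt_one hua]
  calc ∫ x in Ioi 0, Real.exp (-(u * x)) * mlDensity a l x
      = ∫ x in Ioi 0, ∑' k, mlTerm a l u k x :=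
        setIntegral_congr_fun measurableSet_Ioi fun x hx => exp_mul_mlDensity_eq_tsum a l u hx
    _ = ∑' k, ∫ x in Ioi 0, mlTerm a l u k x :=
        (integral_tsum_of_summable_integral_norm (integrableOn_mlTerm ha hu)
          (summable_integral_norm_mlTerm ha hl hu hlu)).symm
    _ = l / u ^ a * (1 - -(l / u ^ a))⁻¹ := by
        simp_rw [integral_mlTerm ha hu]
        rw [tsum_mul_left, tsum_geometric_of_abs_lt_one hratio]
    _ = l / (l + u ^ a) := by
        rw [sub_neg_eq_add]
        field_simp
        rw [add_comm]

theorem mlDensity_ae_nonneg (ha0 : 0 < a) (ha1 : a ≤ 1) (hl : 0 < l) :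
    ∀ᵐ x ∂volume.restrict (Ioi (0 : ℝ)), 0 ≤ mlDensity a l x := by
  have hc : 0 < l ^ a⁻¹ := by positivity
  have hlarge : ∀ u > l ^ a⁻¹, l < u ^ a := fun u hu =>
    (Real.rpow_inv_lt_iff_of_pos hl.le (hc.trans hu).le ha0).1 hu
  exact ae_nonneg_of_laplace_isAlternating
    ((ae_restrict_mem measurableSet_Ioi).mono fun x hx => le_of_lt hx) hc.le
    (fun u hu => integrableOn_exp_mul_mlDensity ha0 hl (hc.trans hu) (hlarge u hu))
    (fun u hu => integral_exp_mul_mlDensity ha0 hl (hc.trans hu) (hlarge u hu))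
    (isAlternating_div_add_rpow ha0.le ha1 hl)

lemma mlMeasure_absolutelyContinuous (a l : ℝ) : mlMeasure a l ≪ volume :=
  (withDensity_absolutelyContinuous _ _).trans Measure.restrict_le_self.absolutelyContinuous

lemma ae_mlMeasure_pos (a l : ℝ) : ∀ᵐ x ∂mlMeasure a l, 0 < x :=
  (withDensity_absolutelyContinuous _ _).ae_le (ae_restrict_mem measurableSet_Ioi)

lemma integrable_exp_neg_mul {μ : Measure ℝ} [IsFiniteMeasure μ] (hμ : ∀ᵐ x ∂μ, 0 ≤ x)
    (hu : 0 ≤ u) : Integrable (fun x => Real.exp (-(u * x))) μ := by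
  refine (integrable_const (1 : ℝ)).mono' (by fun_prop) ?_
  filter_upwards [hμ] with x hx
  rw [Real.norm_of_nonneg (Real.exp_pos _).le, Real.exp_le_one_iff, neg_nonpos]
  exact mul_nonneg hu hx

lemma integral_exp_eq_of_forall_gt {μ : Measure ℝ} [IsFiniteMeasure μ] (hμ : ∀ᵐ x ∂μ, 0 ≤ x)
    {F : ℝ → ℝ} (hF : AnalyticOnNhd ℝ F (Ioi 0)) {c : ℝ}
    (h : ∀ u > c, ∫ x, Real.exp (-(u * x)) ∂μ = F u) (hu : 0 < u) :
    ∫ x, Real.exp (-(u * x)) ∂μ = F u := by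
  have hdomain : Iio (0 : ℝ) ⊆ interior (integrableExpSet id μ) := by
    refine interior_maximal (fun t (ht : t < 0) => ?_) isOpen_Iio
    simpa [integrableExpSet] using integrable_exp_neg_mul hμ (neg_pos.2 ht).le
  have htransform : AnalyticOnNhd ℝ (fun u => ∫ x, Real.exp (-(u * x)) ∂μ) (Ioi 0) := by
    have hneg : MapsTo (fun u : ℝ => -u) (Ioi 0) (Iio 0) := fun u hu =>
      mem_Iio.2 (neg_lt_zero.2 hu)
    simpa [mgf, Function.comp_def] using
      (analyticOnNhd_mgf.mono hdomain).comp analyticOnNhd_id.neg hneg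
  have hc : max c 0 < max c 0 + 1 := lt_add_one _
  refine htransform.eqOn_of_preconnected_of_eventuallyEq hF isPreconnected_Ioi
    (z₀ := max c 0 + 1) ((le_max_right c 0).trans_lt hc) ?_ hu
  filter_upwards [Ioi_mem_nhds ((le_max_left c 0).trans_lt hc)] with u hu
  exact h u hu

theorem integral_exp_mlMeasure (ha0 : 0 < a) (ha1 : a ≤ 1) (hl : 0 < l)
    [IsProbabilityMeasure (mlMeasure a l)] (hu : 0 ≤ u) :
    ∫ x, Real.exp (-(u * x)) ∂mlMeasure a l = l / (l + u ^ a) := by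
  rcases hu.eq_or_lt with rfl | hu
  · simp [Real.zero_rpow ha0.ne', hl.ne']
  have hanalytic : AnalyticOnNhd ℝ (fun u : ℝ => l / (l + u ^ a)) (Ioi 0) := by
    intro u (hu : 0 < u)
    have hpow : AnalyticAt ℝ (fun u : ℝ => u ^ a) u :=
      (Real.contDiffAt_rpow_const_of_ne (n := ⊤) hu.ne').analyticAt
    exact analyticAt_const.div (analyticAt_const.add hpow) (by positivity)
  refine integral_exp_eq_of_forall_gt ((ae_mlMeasure_pos a l).mono fun x hx => hx.le) hanalytic
    (c := l ^ a⁻¹) (fun u hu => ?_) hu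
  have hu0 : 0 < u := (Real.rpow_pos_of_pos hl _).trans hu
  rw [← integral_exp_mul_mlDensity ha0 hl hu0
    ((Real.rpow_inv_lt_iff_of_pos hl.le hu0.le ha0).1 hu)]
  change ∫ x, Real.exp (-(u * x)) ∂(volume.restrict (Ioi 0)).withDensity
    (fun x => ENNReal.ofReal (mlDensity a l x)) = _
  rw [integral_withDensity_ofReal (measurable_mlDensity a l).aemeasurable]
  refine integral_congr_ae ?_
  filter_upwards [mlDensity_ae_nonneg ha0 ha1 hl] with x hx
  rw [max_eq_left hx, mul_comm]

lemma lintegral_ofReal_exp_mlMeasure (ha0 : 0 < a) (ha1 : a ≤ 1) (hl : 0 < l)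
    [IsProbabilityMeasure (mlMeasure a l)] (hu : 0 ≤ u) :
    ∫⁻ x, ENNReal.ofReal (Real.exp (-(u * x))) ∂mlMeasure a l =
      ENNReal.ofReal (l / (l + u ^ a)) := by
  rw [← integral_exp_mlMeasure ha0 ha1 hl hu, ofReal_integral_eq_lintegral_ofReal
    (integrable_exp_neg_mul ((ae_mlMeasure_pos a l).mono fun x hx => hx.le) hu)
    (ae_of_all _ fun _ => (Real.exp_pos _).le)]

lemma map_mul_left_mlMeasure_absolutelyContinuous (a l : ℝ) {c : ℝ} (hc : c ≠ 0) :
    (mlMeasure a l).map (fun x => c * x) ≪ volume := by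
  refine ((mlMeasure_absolutelyContinuous a l).map (measurable_const_mul c)).trans ?_
  rw [Real.map_volume_mul_left hc]
  exact Measure.smul_absolutelyContinuous

end MittagLefflerLaplace

section KilledChain

open Filter Topology

lemma mulVec_mono_of_nonneg {S : Type*} [Fintype S] {M : Matrix S S ℝ} (hM : ∀ x y, 0 ≤ M x y) :
    Monotone (M *ᵥ ·) := fun _ _ h x =>
  Finset.sum_le_sum fun y _ => mul_le_mul_of_nonneg_left (h y) (hM x y)

section Powers

variable {S : Type*} [Fintype S] [DecidableEq S] {M : Matrix S S ℝ}

lemma sum_paths_eq_dotProduct_pow_mulVec (M : Matrix S S ℝ) (f : S → ℝ) (N : ℕ) (μ : S → ℝ) :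
    ∑ x : Fin (N + 1) → S,
        μ (x 0) * (∏ k : Fin N, M (x k.castSucc) (x k.succ)) * f (x (Fin.last N)) =
      μ ⬝ᵥ (M ^ N *ᵥ f) := by
  induction N generalizing μ with
  | zero =>
    rw [pow_zero, Matrix.one_mulVec, dotProduct]
    exact Fintype.sum_equiv (Equiv.funUnique (Fin 1) S) _ _ fun x => by simp
  | succ N ih =>
    rw [pow_succ', ← Matrix.mulVec_mulVec, Matrix.dotProduct_mulVec, ← ih,
      ← Fintype.sum_equiv (Fin.consEquiv fun _ => S)
        (fun p : S × (Fin (N + 1) → S) => μ p.1 * (M p.1 (p.2 0) *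
          ∏ k : Fin N, M (p.2 k.castSucc) (p.2 k.succ)) * f (p.2 (Fin.last N)))
        _ fun p => by simp [Fin.prod_univ_succ, Fin.consEquiv, ← Fin.succ_last],
      Fintype.sum_prod_type_right]
    refine Finset.sum_congr rfl fun x _ => ?_
    simp only [Matrix.vecMul, dotProduct, Finset.sum_mul]
    exact Finset.sum_congr rfl fun y _ => by ring

lemma pow_succ_mulVec (M : Matrix S S ℝ) (N : ℕ) (e : S → ℝ) :
    M ^ (N + 1) *ᵥ e = M *ᵥ (M ^ N *ᵥ e) := by
  rw [pow_succ', Matrix.mulVec_mulVec]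

lemma monotone_pow_mulVec (hM : ∀ x y, 0 ≤ M x y) {e : S → ℝ} (he : e ≤ M *ᵥ e) :
    Monotone fun N => M ^ N *ᵥ e := by
  refine monotone_nat_of_le_succ fun N => ?_
  induction N with
  | zero => simpa using he
  | succ N ih =>
    rw [pow_succ_mulVec, pow_succ_mulVec M (N + 1)]
    exact mulVec_mono_of_nonneg hM ih

lemma pow_mulVec_le (hM : ∀ x y, 0 ≤ M x y) {e b : S → ℝ} (heb : e ≤ b) (hb : M *ᵥ b ≤ b)
    (N : ℕ) : M ^ N *ᵥ e ≤ b := by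
  induction N with
  | zero => simpa using heb
  | succ N ih =>
    rw [pow_succ_mulVec]
    exact (mulVec_mono_of_nonneg hM ih).trans hb

theorem exists_tendsto_pow_mulVec (hM : ∀ x y, 0 ≤ M x y) {e b : S → ℝ} (he : e ≤ M *ᵥ e)
    (heb : e ≤ b) (hb : M *ᵥ b ≤ b) :
    ∃ v, M *ᵥ v = v ∧ e ≤ v ∧ v ≤ b ∧ Tendsto (fun N => M ^ N *ᵥ e) atTop (𝓝 v) := by
  have hmono := monotone_pow_mulVec hM he
  have hbound := pow_mulVec_le hM heb hb
  obtain ⟨v, hv⟩ : ∃ v, Tendsto (fun N => M ^ N *ᵥ e) atTop (𝓝 v) :=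
    ⟨_, tendsto_atTop_ciSup hmono ⟨b, Set.forall_mem_range.2 hbound⟩⟩
  refine ⟨v, ?_, ?_, le_of_tendsto' hv hbound, hv⟩
  · refine tendsto_nhds_unique ?_ ((tendsto_add_atTop_iff_nat 1).2 hv)
    simp_rw [pow_succ_mulVec]
    exact ((Continuous.matrix_mulVec continuous_const continuous_id).tendsto v).comp hv
  · simpa using hmono.ge_of_tendsto hv 0

end Powers

variable {ι : Type*} [Fintype ι] [DecidableEq ι]

/-- The transition matrix of the jump chain of `T` killed at rate `d i` in the phase `i`: a jump
from `i` is survived with probability `λ_i / (λ_i + d_i)`, where `λ_i = - T i i`. -/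
noncomputable def killedMatrix (d : ι → ℝ) (T : Matrix ι ι ℝ) :
    Matrix (Option ι) (Option ι) ℝ :=
  fun x y => (x.elim 1 fun i => -T i i / (-T i i + d i)) * jumpMatrix T x y

variable {T : Matrix ι ι ℝ} {d : ι → ℝ}

lemma killedMatrix_mulVec_none (v : Option ι → ℝ) : (killedMatrix d T *ᵥ v) none = v none := by
  simp [Matrix.mulVec, dotProduct, killedMatrix, Fintype.sum_option, jumpMatrix]

lemma jumpMatrix_mulVec_some (hT : ∀ i, T i i < 0) (v : Option ι → ℝ) (i : ι) :
    -T i i * (jumpMatrix T *ᵥ v) (some i) =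
      (T *ᵥ fun j => v (some j)) i - T i i * v (some i) + exitRates T i * v none := by
  have hi : -T i i ≠ 0 := neg_ne_zero.2 (hT i).ne
  have hphases : -T i i * ∑ j, jumpMatrix T (some i) (some j) * v (some j) =
      (T *ᵥ fun j => v (some j)) i - T i i * v (some i) := by
    rw [Matrix.mulVec, dotProduct, ← Finset.sum_erase_eq_sub (Finset.mem_univ i),
      ← Finset.sum_erase (a := i) Finset.univ (by simp [jumpMatrix]), Finset.mul_sum]
    refine Finset.sum_congr rfl fun j hj => ?_
    rw [jumpMatrix, if_neg (Finset.ne_of_mem_erase hj).symm, ← mul_assoc, mul_div_cancel₀ _ hi]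
  have hexit : -T i i * jumpMatrix T (some i) none = exitRates T i := mul_div_cancel₀ _ hi
  rw [Matrix.mulVec, dotProduct, Fintype.sum_option, mul_add, hphases, ← mul_assoc, hexit, add_comm]

lemma killedMatrix_mulVec_some (hT : ∀ i, T i i < 0) (hd : ∀ i, 0 ≤ d i) (v : Option ι → ℝ)
    (i : ι) :
    (-T i i + d i) * (killedMatrix d T *ᵥ v) (some i) =
      (T *ᵥ fun j => v (some j)) i - T i i * v (some i) + exitRates T i * v none := by
  have hi : -T i i + d i ≠ 0 := by linarith [hT i, hd i]
  have hkill : (killedMatrix d T *ᵥ v) (some i) =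
      -T i i / (-T i i + d i) * (jumpMatrix T *ᵥ v) (some i) := by
    simp only [Matrix.mulVec, dotProduct, killedMatrix, Option.elim_some, Finset.mul_sum, mul_assoc]
  rw [hkill, ← jumpMatrix_mulVec_some hT, ← mul_assoc, mul_div_cancel₀ _ hi]

lemma killedMatrix_nonneg (hT : IsTransientSubIntensity T) (hd : ∀ i, 0 ≤ d i)
    (x y : Option ι) : 0 ≤ killedMatrix d T x y := by
  refine mul_nonneg ?_
    (jumpMatrix_nonneg hT.diag_neg hT.offDiag_nonneg hT.exit_nonneg x y)
  rcases x with _ | i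
  · exact zero_le_one
  · have := hT.diag_neg i
    exact div_nonneg (by linarith) (by linarith [hd i])

lemma killedMatrix_mulVec_one_le (hT : ∀ i, T i i < 0) (hd : ∀ i, 0 ≤ d i) :
    killedMatrix d T *ᵥ 1 ≤ 1 := by
  rintro (_ | i)
  · rw [killedMatrix_mulVec_none]
  · have hsum := killedMatrix_mulVec_some hT hd 1 i
    have hexit : exitRates T i = -(T *ᵥ 1) i := rfl
    simp only [Pi.one_apply, mul_one, hexit, ← Pi.one_def] at hsum ⊢
    have := hT i
    nlinarith [hd i]

lemma eq_inv_mulVec_exitRates_of_killedMatrix_mulVec_eq (hT : IsTransientSubIntensity T)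
    (hd : ∀ i, 0 ≤ d i) {v : Option ι → ℝ} (hv : killedMatrix d T *ᵥ v = v) (hnone : v none = 1) :
    (fun i => v (some i)) = (Matrix.diagonal d - T)⁻¹ *ᵥ exitRates T := by
  refine eq_inv_mulVec_of_isUnit (hT.minimumPrinciple.isUnit_diagonal_sub hd) (funext fun i => ?_)
  have hfix := killedMatrix_mulVec_some hT.diag_neg hd v i
  rw [hv, hnone] at hfix
  rw [Matrix.sub_mulVec, Pi.sub_apply, Matrix.mulVec_diagonal]
  linarith

theorem tendsto_killedMatrix_pow_mulVec (hT : IsTransientSubIntensity T) (hd : ∀ i, 0 ≤ d i) :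
    Tendsto (fun N => killedMatrix d T ^ N *ᵥ Pi.single none 1) atTop
      (𝓝 fun x => x.elim 1 ((Matrix.diagonal d - T)⁻¹ *ᵥ exitRates T)) := by
  have hK := killedMatrix_nonneg hT hd
  have hsub : (Pi.single none 1 : Option ι → ℝ) ≤ killedMatrix d T *ᵥ Pi.single none 1 := by
    rintro (_ | i)
    · rw [killedMatrix_mulVec_none]
    · simp [hK]
  have hle : (Pi.single none 1 : Option ι → ℝ) ≤ 1 := by rintro (_ | i) <;> simp
  obtain ⟨v, hfix, hev, hv1, hlim⟩ :=
    exists_tendsto_pow_mulVec hK hsub hle (killedMatrix_mulVec_one_le hT.diag_neg hd)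
  have hnone : v none = 1 := le_antisymm (hv1 none) (by simpa using hev none)
  convert hlim using 2
  ext x
  rcases x with _ | i
  · exact hnone.symm
  · exact (congrFun (eq_inv_mulVec_exitRates_of_killedMatrix_mulVec_eq hT hd hfix hnone) i).symm

end KilledChain

section PathLaw

open Filter Topology

lemma setLIntegral_preimage_of_indepFun {Ω α β : Type*} [MeasurableSpace Ω] [MeasurableSpace α]
    [MeasurableSpace β] {P : Measure Ω} {X : Ω → α} {Y : Ω → β} (hX : Measurable X)
    (hY : Measurable Y) (hXY : IndepFun X Y P) {B : Set α} (hB : MeasurableSet B)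
    {F : β → ℝ≥0∞} (hF : Measurable F) :
    ∫⁻ ω in X ⁻¹' B, F (Y ω) ∂P = P (X ⁻¹' B) * ∫⁻ ω, F (Y ω) ∂P := by
  have hind : Measurable (B.indicator (1 : α → ℝ≥0∞)) := measurable_one.indicator hB
  have hprod := lintegral_mul_eq_lintegral_mul_lintegral_of_indepFun (hind.comp hX) (hF.comp hY)
    (hXY.comp hind hF)
  have hcomp : B.indicator (1 : α → ℝ≥0∞) ∘ X = (X ⁻¹' B).indicator 1 := rfl
  rw [hcomp, lintegral_indicator_one (hX hB)] at hprod
  rw [← lintegral_indicator (hX hB), ← Function.comp_def F Y, ← hprod]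
  refine lintegral_congr fun ω => ?_
  by_cases hω : ω ∈ X ⁻¹' B <;> simp [hω]

lemma nonempty_of_sum_eq_one {ι : Type*} [Fintype ι] {p : ι → ℝ} (hp : ∑ i, p i = 1) :
    Nonempty ι :=
  Finset.univ_nonempty_iff.1 (Finset.nonempty_of_sum_ne_zero (hp ▸ one_ne_zero))

instance instDiscreteMeasurableSpaceOptionState {ι : Type*} :
    DiscreteMeasurableSpace (Option ι) := ⟨fun _ => MeasurableSpace.measurableSet_top⟩

/-- The event that the first `N + 1` states of the chain are `x 0, …, x N`. -/
def pathEvent {ι Ω : Type*} (J : ℕ → Ω → Option ι) {N : ℕ} (x : Fin (N + 1) → Option ι) : Set Ω :=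
  (fun ω (k : Fin (N + 1)) => J k ω) ⁻¹' {x}

/-- The product of the `h i y` over the first `N` sojourns, where `i` is the phase and `y` the
holding time of the sojourn; a stay in the absorbing state contributes the factor `1`. -/
noncomputable def holdProd {ι Ω : Type*} (h : ι → ℝ → ℝ≥0∞) (J : ℕ → Ω → Option ι)
    (H : ι → ℕ → Ω → ℝ) (N : ℕ) (ω : Ω) : ℝ≥0∞ :=
  ∏ k ∈ Finset.range N, (J k ω).elim 1 fun i => h i (H i k ω)

namespace IsMLMarkovRenewal

variable {ι : Type*} [Fintype ι] [DecidableEq ι] {Ω : Type*} [MeasurableSpace Ω] {P : Measure Ω}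
  {a : ℝ} {π : ι → ℝ} {T : Matrix ι ι ℝ} {J : ℕ → Ω → Option ι} {H : ι → ℕ → Ω → ℝ}

section Paths

variable {N : ℕ}

lemma measurable_path (hJH : IsMLMarkovRenewal P a π T J H) :
    Measurable fun ω (k : Fin (N + 1)) => J k ω :=
  measurable_pi_lambda _ fun k => hJH.measurable_chain k

lemma measurableSet_pathEvent (hJH : IsMLMarkovRenewal P a π T J H) (x : Fin (N + 1) → Option ι) :
    MeasurableSet (pathEvent J x) :=
  hJH.measurable_path (measurableSet_singleton x)

lemma measure_pathEvent (hJH : IsMLMarkovRenewal P a π T J H) (x : Fin (N + 1) → Option ι) :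
    P (pathEvent J x) = ENNReal.ofReal
      ((x 0).elim 0 π * ∏ k : Fin N, jumpMatrix T (x k.castSucc) (x k.succ)) := by
  have hevent : pathEvent J x = {ω | ∀ k ≤ N, J k ω = x (Fin.ofNat (N + 1) k)} := by
    ext ω
    refine ⟨fun h k hk => ?_, fun h => funext fun k => ?_⟩
    · have hk' : J (Fin.ofNat (N + 1) k) ω = _ := congrFun h (Fin.ofNat (N + 1) k)
      rwa [Fin.val_ofNat, Nat.mod_eq_of_lt (by lia)] at hk'
    · have hk := h k (by lia)
      rwa [Fin.ofNat_val_eq_self] at hk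
  rw [hevent, hJH.chain_law N fun k => x (Fin.ofNat (N + 1) k), Finset.prod_range]
  congr 2
  refine Finset.prod_congr rfl fun k _ => ?_
  congr 2 <;> ext <;> simp [Nat.mod_eq_of_lt]

lemma iIndepFun_hold (hJH : IsMLMarkovRenewal P a π T J H) [Nonempty ι] {β : Type*}
    [MeasurableSpace β] (x : Fin N → Option ι) (c : β) {h : ι → ℝ → β}
    (hh : ∀ i, Measurable (h i)) :
    iIndepFun (fun k ω => (x k).elim c fun i => h i (H i k ω)) P := by
  obtain ⟨i₀⟩ := ‹Nonempty ι›
  have hvisited := hJH.indep_hold.precomp (g := fun k : Fin N => ((x k).getD i₀, (k : ℕ)))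
    fun k l hkl => Fin.ext (Prod.ext_iff.1 hkl).2
  have hcomp := hvisited.comp (fun k => (x k).elim (fun _ => c) h) fun k => by
    rcases x k with _ | i
    · exact measurable_const
    · exact hh i
  refine (iIndepFun_congr fun k => ae_of_all _ fun ω => ?_).1 hcomp
  rcases x k with _ | i <;> simp

lemma measurable_hold_elim (hJH : IsMLMarkovRenewal P a π T J H) {β : Type*}
    [MeasurableSpace β] (k : ℕ) (y : Option ι) (c : β) {h : ι → ℝ → β}
    (hh : ∀ i, Measurable (h i)) : Measurable fun ω => y.elim c fun i => h i (H i k ω) := by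
  rcases y with _ | i
  · exact measurable_const
  · exact (hh i).comp (hJH.measurable_hold i k)

lemma lintegral_prod_hold (hJH : IsMLMarkovRenewal P a π T J H) [Nonempty ι]
    [IsProbabilityMeasure P] (x : Fin N → Option ι) {h : ι → ℝ → ℝ≥0∞}
    (hh : ∀ i, Measurable (h i)) :
    ∫⁻ ω, ∏ k, (x k).elim 1 (fun i => h i (H i k ω)) ∂P =
      ∏ k, (x k).elim 1 fun i => ∫⁻ y, h i y ∂mlMeasure a (-T i i) := by
  rw [lintegral_prod_eq_prod_lintegral_of_indepFun Finset.univ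
    (fun k ω => (x k).elim 1 fun i => h i (H i k ω)) (hJH.iIndepFun_hold x 1 hh)
    (fun k => hJH.measurable_hold_elim k (x k) 1 hh)]
  refine Finset.prod_congr rfl fun k _ => ?_
  rcases x k with _ | i
  · simp
  · simp only [Option.elim_some]
    rw [← hJH.hold_law i k, lintegral_map (hh i) (hJH.measurable_hold i k)]

lemma setLIntegral_pathEvent_holdProd (hJH : IsMLMarkovRenewal P a π T J H)
    {h : ι → ℝ → ℝ≥0∞} (hh : ∀ i, Measurable (h i)) (x : Fin (N + 1) → Option ι) :
    ∫⁻ ω in pathEvent J x, holdProd h J H N ω ∂P =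
      P (pathEvent J x) *
        ∫⁻ ω, ∏ k : Fin N, (x k.castSucc).elim 1 (fun i => h i (H i k ω)) ∂P := by
  have hpath : Set.EqOn (holdProd h J H N)
      (fun ω => ∏ k : Fin N, (x k.castSucc).elim 1 fun i => h i (H i k ω)) (pathEvent J x) := by
    rintro ω rfl
    exact Finset.prod_range _
  rw [setLIntegral_congr_fun (hJH.measurableSet_pathEvent x) hpath]
  have hF : Measurable fun y : ι × ℕ → ℝ =>
      ∏ k : Fin N, (x k.castSucc).elim 1 fun i => h i (y (i, k)) := by
    refine Finset.measurable_fun_prod _ fun k _ => ?_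
    rcases x k.castSucc with _ | i
    · exact measurable_const
    · exact (hh i).comp (measurable_pi_apply _)
  exact setLIntegral_preimage_of_indepFun hJH.measurable_path
    (measurable_pi_lambda _ fun q => hJH.measurable_hold q.1 q.2)
    (hJH.indep_chain_hold.comp (measurable_pi_lambda _ fun k => measurable_pi_apply _)
      measurable_id) (measurableSet_singleton x) hF

lemma setLIntegral_pathEvent_holdProd_eq_prod_killedMatrix (hJH : IsMLMarkovRenewal P a π T J H)
    [Nonempty ι] [IsProbabilityMeasure P] (hT : IsTransientSubIntensity T) {d : ι → ℝ}
    (hd : ∀ i, 0 ≤ d i) {h : ι → ℝ → ℝ≥0∞} (hh : ∀ i, Measurable (h i))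
    (hhd : ∀ i, ∫⁻ y, h i y ∂mlMeasure a (-T i i) = ENNReal.ofReal (-T i i / (-T i i + d i)))
    (x : Fin (N + 1) → Option ι) :
    ∫⁻ ω in pathEvent J x, holdProd h J H N ω ∂P = ENNReal.ofReal
      ((x 0).elim 0 π * ∏ k : Fin N, killedMatrix d T (x k.castSucc) (x k.succ)) := by
  have hsurvive (y : Option ι) : 0 ≤ y.elim 1 fun i => -T i i / (-T i i + d i) := by
    rcases y with _ | i
    · exact zero_le_one
    · exact div_nonneg (neg_nonneg.2 (hT.diag_neg i).le) (by linarith [hT.diag_neg i, hd i])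
  have hfactor (y : Option ι) : (y.elim 1 fun i => ∫⁻ y, h i y ∂mlMeasure a (-T i i)) =
      ENNReal.ofReal (y.elim 1 fun i => -T i i / (-T i i + d i)) := by
    rcases y with _ | i
    · simp
    · exact hhd i
  rw [hJH.setLIntegral_pathEvent_holdProd hh, hJH.measure_pathEvent,
    hJH.lintegral_prod_hold (fun k => x k.castSucc) hh]
  simp only [hfactor, killedMatrix, Finset.prod_mul_distrib]
  rw [← ENNReal.ofReal_prod_of_nonneg fun k _ => hsurvive _,
    ← ENNReal.ofReal_mul' (Finset.prod_nonneg fun k _ => hsurvive _)]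
  congr 1
  ring

end Paths

lemma measurableSet_chain_eq (hJH : IsMLMarkovRenewal P a π T J H) (n : ℕ) (x : Option ι) :
    MeasurableSet {ω | J n ω = x} :=
  hJH.measurable_chain n (measurableSet_singleton x)

theorem setLIntegral_holdProd (hJH : IsMLMarkovRenewal P a π T J H) [Nonempty ι]
    [IsProbabilityMeasure P] (hT : IsTransientSubIntensity T) (hπ0 : ∀ i, 0 ≤ π i) {d : ι → ℝ}
    (hd : ∀ i, 0 ≤ d i) {h : ι → ℝ → ℝ≥0∞} (hh : ∀ i, Measurable (h i))
    (hhd : ∀ i, ∫⁻ y, h i y ∂mlMeasure a (-T i i) = ENNReal.ofReal (-T i i / (-T i i + d i)))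
    (N : ℕ) (y : Option ι) :
    ∫⁻ ω in {ω | J N ω = y}, holdProd h J H N ω ∂P = ENNReal.ofReal
      ((fun x : Option ι => x.elim 0 π) ⬝ᵥ (killedMatrix d T ^ N *ᵥ Pi.single y 1)) := by
  have hevent : {ω | J N ω = y} =
      ⋃ x ∈ ({x | x (Fin.last N) = y} : Finset (Fin (N + 1) → Option ι)), pathEvent J x := by
    ext ω
    simp [pathEvent]
  have hnonneg (x : Fin (N + 1) → Option ι) :
      0 ≤ (x 0).elim 0 π * ∏ k : Fin N, killedMatrix d T (x k.castSucc) (x k.succ) := by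
    refine mul_nonneg ?_ (Finset.prod_nonneg fun k _ => killedMatrix_nonneg hT hd _ _)
    rcases x 0 with _ | i
    exacts [le_rfl, hπ0 i]
  rw [hevent, lintegral_biUnion_finset (t := pathEvent J) (Set.pairwiseDisjoint_fiber _ _)
    fun x _ => hJH.measurableSet_pathEvent x,
    Finset.sum_congr rfl fun x _ =>
      hJH.setLIntegral_pathEvent_holdProd_eq_prod_killedMatrix hT hd hh hhd x,
    ← ENNReal.ofReal_sum_of_nonneg fun x _ => hnonneg x, ← sum_paths_eq_dotProduct_pow_mulVec,
    Finset.sum_filter]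
  simp [Pi.single_apply]

theorem tendsto_setLIntegral_holdProd (hJH : IsMLMarkovRenewal P a π T J H) [Nonempty ι]
    [IsProbabilityMeasure P] (hT : IsTransientSubIntensity T) (hπ0 : ∀ i, 0 ≤ π i) {d : ι → ℝ}
    (hd : ∀ i, 0 ≤ d i) {h : ι → ℝ → ℝ≥0∞} (hh : ∀ i, Measurable (h i))
    (hhd : ∀ i, ∫⁻ y, h i y ∂mlMeasure a (-T i i) = ENNReal.ofReal (-T i i / (-T i i + d i))) :
    Tendsto (fun N => ∫⁻ ω in {ω | J N ω = none}, holdProd h J H N ω ∂P) atTop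
      (𝓝 (ENNReal.ofReal (π ⬝ᵥ ((Matrix.diagonal d - T)⁻¹ *ᵥ exitRates T)))) := by
  simp_rw [hJH.setLIntegral_holdProd hT hπ0 hd hh hhd]
  have hlim := ((continuous_const (y := fun x : Option ι => x.elim 0 π)).dotProduct
    continuous_id).tendsto _ |>.comp (tendsto_killedMatrix_pow_mulVec hT hd)
  have hphases (v : ι → ℝ) :
      (fun x : Option ι => x.elim 0 π) ⬝ᵥ (fun x => x.elim 1 v) = π ⬝ᵥ v := by
    simp [dotProduct, Fintype.sum_option]
  rw [← hphases]
  exact ENNReal.tendsto_ofReal hlim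

lemma isProbabilityMeasure_mlMeasure (hJH : IsMLMarkovRenewal P a π T J H)
    [IsProbabilityMeasure P] (i : ι) : IsProbabilityMeasure (mlMeasure a (-T i i)) :=
  hJH.hold_law i 0 ▸ Measure.isProbabilityMeasure_map (hJH.measurable_hold i 0).aemeasurable

theorem ae_exists_chain_eq_none (hJH : IsMLMarkovRenewal P a π T J H)
    [IsProbabilityMeasure P] (hT : IsTransientSubIntensity T) (hπ0 : ∀ i, 0 ≤ π i)
    (hπ1 : ∑ i, π i = 1) : ∀ᵐ ω ∂P, ∃ N, J N ω = none := by
  have := nonempty_of_sum_eq_one hπ1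
  have hlim := hJH.tendsto_setLIntegral_holdProd hT hπ0 (d := 0) (h := fun _ _ => 1)
    (fun _ => le_rfl) (fun _ => measurable_const) fun i => by
      have := hJH.isProbabilityMeasure_mlMeasure i
      simp [(hT.diag_neg i).ne]
  have hexit : (Matrix.diagonal (0 : ι → ℝ) - T)⁻¹ *ᵥ exitRates T = 1 := by
    rw [Matrix.diagonal_zero', zero_sub]
    exact (eq_inv_mulVec_of_isUnit hT.minimumPrinciple.isUnit_neg (Matrix.neg_mulVec _ _)).symm
  rw [hexit, dotProduct_one, hπ1, ENNReal.ofReal_one] at hlim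
  have hle (N : ℕ) : ∫⁻ ω in {ω | J N ω = none}, holdProd (fun _ _ => 1) J H N ω ∂P ≤
      P {ω | ∃ N, J N ω = none} := by
    have hone (ω : Ω) : holdProd (fun _ _ => 1) J H N ω = 1 :=
      Finset.prod_eq_one fun k _ => by rcases J k ω with _ | i <;> rfl
    simp only [hone, setLIntegral_one]
    exact measure_mono fun ω hω => ⟨N, hω⟩
  have hm : MeasurableSet {ω | ∃ N, J N ω = none} := by
    rw [Set.ofPred_exists]
    exact MeasurableSet.iUnion fun N => hJH.measurableSet_chain_eq N none
  exact (prob_compl_eq_zero_iff hm).2 (le_antisymm prob_le_one (le_of_tendsto' hlim hle))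

lemma ae_chain_succ_absorbed (hJH : IsMLMarkovRenewal P a π T J H) (n : ℕ) :
    ∀ᵐ ω ∂P, J n ω = none → J (n + 1) ω = none := by
  have hpath (x : Fin (n + 2) → Option ι) (hx : x (Fin.last n).castSucc = none)
      (hx' : x (Fin.last n).succ ≠ none) : ∀ᵐ ω ∂P, ω ∉ pathEvent J x := by
    obtain ⟨i, hi⟩ := Option.ne_none_iff_exists'.1 hx'
    refine measure_eq_zero_iff_ae_notMem.1 ?_
    rw [hJH.measure_pathEvent, Finset.prod_eq_zero (Finset.mem_univ (Fin.last n)), mul_zero,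
      ENNReal.ofReal_zero]
    rw [hx, hi]
    rfl
  filter_upwards [ae_all_iff.2 fun x => ae_all_iff.2 fun hx => ae_all_iff.2 (hpath x hx)]
    with ω hω hn
  by_contra hn'
  exact hω (fun k => J k ω) hn hn' rfl

lemma ae_chain_absorbed (hJH : IsMLMarkovRenewal P a π T J H) :
    ∀ᵐ ω ∂P, ∀ m n, m ≤ n → J m ω = none → J n ω = none := by
  filter_upwards [ae_all_iff.2 hJH.ae_chain_succ_absorbed] with ω hω m n hmn hm
  induction n, hmn using Nat.le_induction with
  | base => exact hm
  | succ n _ ih => exact hω n ih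

lemma ae_hold_pos (hJH : IsMLMarkovRenewal P a π T J H) : ∀ᵐ ω ∂P, ∀ i n, 0 < H i n ω := by
  refine ae_all_iff.2 fun i => ae_all_iff.2 fun n => ?_
  have hpos := ae_mlMeasure_pos a (-T i i)
  rw [← hJH.hold_law i n] at hpos
  exact ae_of_ae_map (hJH.measurable_hold i n).aemeasurable hpos

theorem lintegral_eq_of_eq_holdProd (hJH : IsMLMarkovRenewal P a π T J H)
    [IsProbabilityMeasure P] (hT : IsTransientSubIntensity T) (hπ0 : ∀ i, 0 ≤ π i)
    (hπ1 : ∑ i, π i = 1) {d : ι → ℝ} (hd : ∀ i, 0 ≤ d i) {h : ι → ℝ → ℝ≥0∞}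
    (hh : ∀ i, Measurable (h i))
    (hhd : ∀ i, ∫⁻ y, h i y ∂mlMeasure a (-T i i) = ENNReal.ofReal (-T i i / (-T i i + d i)))
    {f : Ω → ℝ≥0∞} (hfm : AEMeasurable f P)
    (hf : ∀ᵐ ω ∂P, ∀ N, J N ω = none → f ω = holdProd h J H N ω) :
    ∫⁻ ω, f ω ∂P =
      ENNReal.ofReal (π ⬝ᵥ ((Matrix.diagonal d - T)⁻¹ *ᵥ exitRates T)) := by
  have := nonempty_of_sum_eq_one hπ1
  refine tendsto_nhds_unique ?_ (hJH.tendsto_setLIntegral_holdProd hT hπ0 hd hh hhd)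
  have hindicator (N : ℕ) : ∫⁻ ω in {ω | J N ω = none}, holdProd h J H N ω ∂P =
      ∫⁻ ω, {ω | J N ω = none}.indicator f ω ∂P := by
    rw [lintegral_indicator (hJH.measurableSet_chain_eq N none)]
    refine setLIntegral_congr_fun_ae (hJH.measurableSet_chain_eq N none) ?_
    filter_upwards [hf] with ω hω hN using (hω N hN).symm
  simp_rw [hindicator]
  refine lintegral_tendsto_of_tendsto_of_monotone
    (fun N => hfm.indicator (hJH.measurableSet_chain_eq N none)) ?_ ?_
  · filter_upwards [hJH.ae_chain_absorbed] with ω hω m n hmn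
    by_cases hm : J m ω = none <;> simp [hm, hω m n hmn]
  · filter_upwards [hJH.ae_chain_absorbed, hJH.ae_exists_chain_eq_none hT hπ0 hπ1]
      with ω hω ⟨m, hm⟩
    refine tendsto_const_nhds.congr' ?_
    filter_upwards [eventually_ge_atTop m] with n hn
    exact (Set.indicator_of_mem (s := {ω | J n ω = none}) (hω m n hn hm) f).symm

end IsMLMarkovRenewal

end PathLaw

section Trajectory

variable {ι Ω : Type*} {J : ℕ → Ω → Option ι} {H : ι → ℕ → Ω → ℝ} {ω : Ω} {n : ℕ}

lemma jumpTime_succ (n : ℕ) :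
    jumpTime J H (n + 1) ω = jumpTime J H n ω + sojourn J H n ω :=
  Finset.sum_range_succ _ _

lemma monotone_jumpTime : Monotone fun n => jumpTime J H n ω :=
  monotone_nat_of_le_succ fun n => by
    rw [jumpTime_succ]
    exact le_self_add

lemma jumpTime_ne_top (h : ∀ k < n, J k ω ≠ none) : jumpTime J H n ω ≠ ⊤ := by
  refine ENNReal.sum_ne_top.2 fun k hk => ?_
  obtain ⟨i, hi⟩ := Option.ne_none_iff_exists'.1 (h k (Finset.mem_range.1 hk))
  simp [sojourn, hi]

lemma semiMarkov_eq {t : ℝ} (h1 : jumpTime J H n ω ≤ ENNReal.ofReal t)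
    (h2 : ENNReal.ofReal t < jumpTime J H (n + 1) ω) : semiMarkov J H t ω = J n ω := by
  classical
  have h : ∃ n : ℕ, jumpTime J H n ω ≤ ENNReal.ofReal t ∧
      ENNReal.ofReal t < jumpTime J H (n + 1) ω := ⟨n, h1, h2⟩
  rw [semiMarkov, dif_pos h]
  congr 1
  rw [Nat.find_eq_iff]
  refine ⟨⟨h1, h2⟩, fun m hm hm' => ?_⟩
  exact absurd (hm'.2.trans_le (monotone_jumpTime (Nat.succ_le_of_lt hm))) (not_lt.2 h1)

lemma exists_jumpTime_le_lt {s : ℝ≥0∞} (h : s < jumpTime J H n ω) :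
    ∃ m < n, jumpTime J H m ω ≤ s ∧ s < jumpTime J H (m + 1) ω := by
  induction n with
  | zero => simp [jumpTime] at h
  | succ n ih =>
    by_cases hn : s < jumpTime J H n ω
    · obtain ⟨m, hm, hm'⟩ := ih hn
      exact ⟨m, by lia, hm'⟩
    · exact ⟨n, n.lt_succ_self, not_lt.1 hn, h⟩

lemma absorptionTime_eq (h : ∀ k < n, J k ω ≠ none) (hn : J n ω = none) :
    absorptionTime (semiMarkov J H) ω = jumpTime J H n ω := by
  have htop := jumpTime_ne_top (H := H) h
  refine le_antisymm ?_ ?_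
  · have hreal : ENNReal.ofReal (jumpTime J H n ω).toReal = jumpTime J H n ω :=
      ENNReal.ofReal_toReal htop
    refine iInf_le_of_le (jumpTime J H n ω).toReal (iInf_le_of_le ENNReal.toReal_nonneg
      (iInf_le_of_le ?_ hreal.le))
    rw [semiMarkov_eq (n := n) hreal.ge, hn]
    rw [hreal, jumpTime_succ, sojourn, hn]
    simpa using htop.lt_top
  · refine le_iInf fun t => le_iInf fun _ => le_iInf fun ht => ?_
    by_contra! hlt
    obtain ⟨m, hm, hle, hlt'⟩ := exists_jumpTime_le_lt hlt
    exact h m hm (semiMarkov_eq hle hlt' ▸ ht)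

lemma setOf_ofReal_lt_eq_Ico {c : ℝ≥0∞} (hc : c ≠ ⊤) :
    {t : ℝ | 0 ≤ t ∧ ENNReal.ofReal t < c} = Set.Ico 0 c.toReal :=
  Set.ext fun _ => and_congr_right fun ht => ENNReal.ofReal_lt_iff_lt_toReal ht hc

lemma semiMarkov_eq_of_mem_Ico (h : ∀ k < n + 1, J k ω ≠ none) {t : ℝ}
    (ht : t ∈ Set.Ico (jumpTime J H n ω).toReal (jumpTime J H (n + 1) ω).toReal) :
    semiMarkov J H t ω = J n ω := by
  have ht0 : 0 ≤ t := ENNReal.toReal_nonneg.trans ht.1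
  exact semiMarkov_eq
    ((ENNReal.le_ofReal_iff_toReal_le (jumpTime_ne_top fun k hk => h k (by lia)) ht0).2 ht.1)
    ((ENNReal.ofReal_lt_iff_lt_toReal ht0 (jumpTime_ne_top h)).2 ht.2)

lemma setLIntegral_reward_sojourn (r : ι → ℝ) (hH : ∀ i n, 0 ≤ H i n ω)
    (h : ∀ k < n + 1, J k ω ≠ none) :
    ∫⁻ t in Set.Ico (jumpTime J H n ω).toReal (jumpTime J H (n + 1) ω).toReal,
        (semiMarkov J H t ω).elim 0 (fun i => ENNReal.ofReal (r i)) =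
      (J n ω).elim 0 fun i => ENNReal.ofReal (r i * H i n ω) := by
  obtain ⟨i, hi⟩ := Option.ne_none_iff_exists'.1 (h n n.lt_succ_self)
  have hlength : (jumpTime J H (n + 1) ω).toReal - (jumpTime J H n ω).toReal = H i n ω := by
    rw [jumpTime_succ, sojourn, hi, Option.elim_some, ENNReal.toReal_add
      (jumpTime_ne_top fun k hk => h k (by lia)) ENNReal.ofReal_ne_top,
      ENNReal.toReal_ofReal (hH i n), add_sub_cancel_left]
  rw [setLIntegral_congr_fun (g := fun _ => ENNReal.ofReal (r i)) measurableSet_Ico fun t ht => by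
      rw [semiMarkov_eq_of_mem_Ico h ht, hi, Option.elim_some],
    setLIntegral_const, Real.volume_Ico, hlength, hi, Option.elim_some,
    ENNReal.ofReal_mul' (hH i n)]

lemma setLIntegral_reward_Ico_jumpTime (r : ι → ℝ) (hH : ∀ i n, 0 ≤ H i n ω)
    (h : ∀ k < n, J k ω ≠ none) :
    ∫⁻ t in Set.Ico 0 (jumpTime J H n ω).toReal,
        (semiMarkov J H t ω).elim 0 (fun i => ENNReal.ofReal (r i)) =
      ∑ k ∈ Finset.range n, (J k ω).elim 0 fun i => ENNReal.ofReal (r i * H i k ω) := by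
  induction n with
  | zero => simp [jumpTime]
  | succ n ih =>
    have hle : (jumpTime J H n ω).toReal ≤ (jumpTime J H (n + 1) ω).toReal :=
      ENNReal.toReal_mono (jumpTime_ne_top h) (monotone_jumpTime n.le_succ)
    rw [← Set.Ico_union_Ico_eq_Ico ENNReal.toReal_nonneg hle,
      lintegral_union measurableSet_Ico (Set.Ico_disjoint_Ico_same),
      ih fun k hk => h k (by lia), setLIntegral_reward_sojourn r hH h, Finset.sum_range_succ]

variable [Fintype ι]

lemma sum_ite_eq_some {M : Type*} [AddCommMonoid M] (x : Option ι) (f : ι → M)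
    [∀ i, Decidable (x = some i)] : ∑ i, (if x = some i then f i else 0) = x.elim 0 f := by
  rcases x with _ | i
  · simp
  · rw [Finset.sum_eq_single i (fun j _ hj => if_neg fun h => hj (Option.some_inj.1 h).symm)
      (by simp), if_pos rfl, Option.elim_some]

theorem totalReward_eq_sum (r : ι → ℝ) (hH : ∀ i n, 0 ≤ H i n ω) {N : ℕ}
    (hN : J N ω = none) (habs : ∀ m n, m ≤ n → J m ω = none → J n ω = none) :
    totalReward r (semiMarkov J H) ω =
      ∑ k ∈ Finset.range N, (J k ω).elim 0 fun i => ENNReal.ofReal (r i * H i k ω) := by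
  classical
  have hex : ∃ n, J n ω = none := ⟨N, hN⟩
  have hlt : ∀ k < Nat.find hex, J k ω ≠ none := fun k hk => Nat.find_min hex hk
  simp_rw [totalReward, sum_ite_eq_some]
  rw [absorptionTime_eq hlt (Nat.find_spec hex), setOf_ofReal_lt_eq_Ico (jumpTime_ne_top hlt),
    setLIntegral_reward_Ico_jumpTime r hH hlt]
  refine Finset.sum_subset (Finset.range_subset_range.2 (Nat.find_min' hex hN)) fun k _ hk => ?_
  rw [habs _ k (not_lt.1 fun h => hk (Finset.mem_range.2 h)) (Nat.find_spec hex), Option.elim_none]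

end Trajectory

section AtomAtZero

open Filter Topology

lemma tendsto_integral_exp_neg_mul_atTop {ν : Measure ℝ} [IsFiniteMeasure ν]
    (hν : ∀ᵐ x ∂ν, 0 ≤ x) :
    Tendsto (fun u : ℝ => ∫ x, Real.exp (-u * x) ∂ν) atTop (𝓝 (ν.real {0})) := by
  rw [← integral_indicator_one (measurableSet_singleton (0 : ℝ))]
  refine tendsto_integral_filter_of_dominated_convergence (fun _ => 1)
    (Eventually.of_forall fun u => by fun_prop) ?_ (integrable_const 1) ?_
  · filter_upwards [eventually_ge_atTop 0] with u hu
    filter_upwards [hν] with x hx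
    rw [Real.norm_of_nonneg (Real.exp_pos _).le, Real.exp_le_one_iff, neg_mul, neg_nonpos]
    exact mul_nonneg hu hx
  · filter_upwards [hν] with x hx
    rcases hx.eq_or_lt with rfl | hx
    · simp
    · rw [Set.indicator_of_notMem (Set.mem_singleton_iff.not.2 hx.ne')]
      exact Real.tendsto_exp_atBot.comp (tendsto_neg_atTop_atBot.atBot_mul_const hx)

variable {κ : Type*} [Fintype κ] [DecidableEq κ]

open scoped Matrix.Norms.Operator in
lemma tendsto_inv_smul_one_sub (S : Matrix κ κ ℝ) :
    Tendsto (fun s : ℝ => (s • (1 : Matrix κ κ ℝ) - S)⁻¹) atTop (𝓝 0) := by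
  have hresolvent (s : ℝ) : (s • (1 : Matrix κ κ ℝ) - S)⁻¹ = resolvent S s := by
    rw [Matrix.nonsing_inv_eq_ringInverse, resolvent, Algebra.algebraMap_eq_smul_one]
  simp_rw [hresolvent]
  exact (spectrum.resolvent_tendsto_cobounded S).mono_left IsOrderBornology.atTop_le_cobounded

variable {ν : Measure ℝ} [IsFiniteMeasure ν] {a c : ℝ} {S : Matrix κ κ ℝ} {β b : κ → ℝ}

lemma measureReal_singleton_zero_of_laplace (ha : 0 < a) (hν : ∀ᵐ x ∂ν, 0 ≤ x)
    (hlaplace : ∀ u, 0 ≤ u → ∫ x, Real.exp (-u * x) ∂ν =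
      β ⬝ᵥ (((u ^ a) • (1 : Matrix κ κ ℝ) - S)⁻¹ *ᵥ b) + c) : ν.real {0} = c := by
  have hcont : Continuous fun A : Matrix κ κ ℝ => β ⬝ᵥ (A *ᵥ b) + c := by fun_prop
  have hlim := (hcont.tendsto 0).comp ((tendsto_inv_smul_one_sub S).comp (tendsto_rpow_atTop ha))
  rw [Matrix.zero_mulVec, dotProduct_zero, zero_add] at hlim
  refine tendsto_nhds_unique (tendsto_integral_exp_neg_mul_atTop hν) (hlim.congr' ?_)
  filter_upwards [eventually_ge_atTop 0] with u hu using (hlaplace u hu).symm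

lemma setIntegral_exp_compl_singleton_zero_of_laplace (ha : 0 < a) (hν : ∀ᵐ x ∂ν, 0 ≤ x)
    (hlaplace : ∀ u, 0 ≤ u → ∫ x, Real.exp (-u * x) ∂ν =
      β ⬝ᵥ (((u ^ a) • (1 : Matrix κ κ ℝ) - S)⁻¹ *ᵥ b) + c) {u : ℝ} (hu : 0 ≤ u) :
    ∫ x in {0}ᶜ, Real.exp (-u * x) ∂ν = β ⬝ᵥ (((u ^ a) • (1 : Matrix κ κ ℝ) - S)⁻¹ *ᵥ b) := by
  have hint : Integrable (fun x => Real.exp (-u * x)) ν := by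
    simpa only [neg_mul] using integrable_exp_neg_mul hν hu
  rw [setIntegral_compl (measurableSet_singleton 0) hint, hlaplace u hu, integral_singleton,
    measureReal_singleton_zero_of_laplace ha hν hlaplace]
  simp

end AtomAtZero

section RewardLaw

lemma ae_sum_notMem_of_iIndepFun {Ω κ : Type*} [MeasurableSpace Ω] {P : Measure Ω}
    [IsProbabilityMeasure P] {X : κ → Ω → ℝ} (hX : ∀ k, Measurable (X k)) (hind : iIndepFun X P)
    (hac : ∀ k, X k = 0 ∨ P.map (X k) ≪ volume) {A : Set ℝ} (hA : volume A = 0)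
    (h0 : (0 : ℝ) ∉ A) (s : Finset κ) : ∀ᵐ ω ∂P, ∑ k ∈ s, X k ω ∉ A := by
  classical
  induction s using Finset.induction_on with
  | empty => simp [h0]
  | insert k s hk ih =>
    rcases hac k with hzero | hac
    · simpa [Finset.sum_insert hk, hzero] using ih
    · have hm : Measurable (∑ j ∈ s, X j) :=
        Finset.sum_induction _ _ (fun _ _ => Measurable.add) measurable_zero fun j _ => hX j
      have hconv := (hind.indepFun_finsetSum_of_notMem hX hk).map_add_eq_map_conv_map hm (hX k)
      have := Measure.isProbabilityMeasure_map (hX k).aemeasurable (μ := P)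
      have hlaw : ∀ᵐ y ∂P.map (∑ j ∈ s, X j + X k), y ∉ A :=
        measure_eq_zero_iff_ae_notMem.1 (hconv ▸ Measure.conv_absolutelyContinuous hac hA)
      filter_upwards [ae_of_ae_map (hm.add (hX k)).aemeasurable hlaw] with ω hω
      simpa [Finset.sum_insert hk, add_comm] using hω

/-- The law of the total reward `Y`; the null event that `Y` is infinite is sent to `0`. -/
noncomputable def rewardLaw {ι Ω : Type*} [Fintype ι] [MeasurableSpace Ω] (P : Measure Ω)
    (r : ι → ℝ) (J : ℕ → Ω → Option ι) (H : ι → ℕ → Ω → ℝ) : Measure ℝ :=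
  P.map fun ω => (totalReward r (semiMarkov J H) ω).toReal

namespace IsMLMarkovRenewal

variable {ι : Type*} [Fintype ι] [DecidableEq ι] {Ω : Type*} [MeasurableSpace Ω] {P : Measure Ω}
  {a : ℝ} {π : ι → ℝ} {T : Matrix ι ι ℝ} {J : ℕ → Ω → Option ι} {H : ι → ℕ → Ω → ℝ}

lemma ae_sum_reward_notMem (hJH : IsMLMarkovRenewal P a π T J H) [Nonempty ι]
    [IsProbabilityMeasure P] (r : ι → ℝ) {N : ℕ} (x : Fin N → Option ι) {A : Set ℝ}
    (hA : volume A = 0) (h0 : (0 : ℝ) ∉ A) :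
    ∀ᵐ ω ∂P, ∑ k, ((x k).elim 0 fun i => r i * H i k ω) ∉ A := by
  refine ae_sum_notMem_of_iIndepFun
    (X := fun k ω => (x k).elim 0 fun i => r i * H i k ω)
    (fun k => hJH.measurable_hold_elim k (x k) 0 fun i => measurable_const_mul (r i))
    (hJH.iIndepFun_hold x 0 fun i => measurable_const_mul (r i)) (fun k => ?_) hA h0 Finset.univ
  rcases x k with _ | i
  · exact Or.inl rfl
  rcases eq_or_ne (r i) 0 with hi | hi
  · exact Or.inl (funext fun ω => by simp [hi])
  · refine Or.inr ?_
    have hmap := map_mul_left_mlMeasure_absolutelyContinuous a (-T i i) hi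
    rwa [← hJH.hold_law i k,
      Measure.map_map (measurable_const_mul (r i)) (hJH.measurable_hold i k)] at hmap

lemma ae_totalReward_eq_sum (hJH : IsMLMarkovRenewal P a π T J H) (r : ι → ℝ) :
    ∀ᵐ ω ∂P, ∀ N, J N ω = none → totalReward r (semiMarkov J H) ω =
      ∑ k ∈ Finset.range N, (J k ω).elim 0 fun i => ENNReal.ofReal (r i * H i k ω) := by
  filter_upwards [hJH.ae_hold_pos, hJH.ae_chain_absorbed] with ω hpos habs N hN
    using totalReward_eq_sum r (fun i n => (hpos i n).le) hN habs

lemma ae_toReal_totalReward_eq_sum (hJH : IsMLMarkovRenewal P a π T J H) {r : ι → ℝ}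
    (hr : ∀ i, 0 ≤ r i) :
    ∀ᵐ ω ∂P, ∀ N, J N ω = none → (totalReward r (semiMarkov J H) ω).toReal =
      ∑ k ∈ Finset.range N, (J k ω).elim 0 fun i => r i * H i k ω := by
  filter_upwards [hJH.ae_totalReward_eq_sum r, hJH.ae_hold_pos] with ω hω hpos N hN
  rw [hω N hN, ENNReal.toReal_sum fun k _ => by rcases J k ω with _ | i <;> simp]
  refine Finset.sum_congr rfl fun k _ => ?_
  rcases J k ω with _ | i
  · rfl
  · exact ENNReal.toReal_ofReal (mul_nonneg (hr i) (hpos i k).le)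

lemma ae_ofReal_exp_totalReward_eq_holdProd (hJH : IsMLMarkovRenewal P a π T J H)
    {r : ι → ℝ} (hr : ∀ i, 0 ≤ r i) (u : ℝ) : ∀ᵐ ω ∂P, ∀ N, J N ω = none →
      ENNReal.ofReal (Real.exp (-u * (totalReward r (semiMarkov J H) ω).toReal)) =
        holdProd (fun i y => ENNReal.ofReal (Real.exp (-(u * r i * y)))) J H N ω := by
  filter_upwards [hJH.ae_toReal_totalReward_eq_sum hr] with ω hω N hN
  rw [hω N hN, Finset.mul_sum, Real.exp_sum,
    ENNReal.ofReal_prod_of_nonneg fun _ _ => (Real.exp_pos _).le]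
  refine Finset.prod_congr rfl fun k _ => ?_
  rcases J k ω with _ | i
  · simp
  · simp only [Option.elim_some, neg_mul, mul_assoc]

section Absorbed

variable [IsProbabilityMeasure P]

lemma aemeasurable_totalReward (hJH : IsMLMarkovRenewal P a π T J H)
    (hT : IsTransientSubIntensity T) (hπ0 : ∀ i, 0 ≤ π i) (hπ1 : ∑ i, π i = 1) (r : ι → ℝ) :
    AEMeasurable (fun ω => totalReward r (semiMarkov J H) ω) P := by
  classical
  have hterm (k : ℕ) :
      Measurable fun ω => (J k ω).elim 0 fun i => ENNReal.ofReal (r i * H i k ω) := by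
    simp_rw [← sum_ite_eq_some]
    exact Finset.measurable_fun_sum _ fun i _ => Measurable.ite
      (hJH.measurableSet_chain_eq k (some i))
      ((hJH.measurable_hold i k).const_mul (r i)).ennreal_ofReal measurable_const
  refine ⟨fun ω => ∑' k, (J k ω).elim 0 fun i => ENNReal.ofReal (r i * H i k ω),
    Measurable.tsum hterm, ?_⟩
  filter_upwards [hJH.ae_totalReward_eq_sum r, hJH.ae_chain_absorbed,
    hJH.ae_exists_chain_eq_none hT hπ0 hπ1] with ω hω habs ⟨N, hN⟩
  rw [hω N hN]
  refine (tsum_eq_sum fun k hk => ?_).symm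
  rw [habs N k (not_lt.1 fun h => hk (Finset.mem_range.2 h)) hN, Option.elim_none]

theorem ae_totalReward_lt_top (hJH : IsMLMarkovRenewal P a π T J H)
    (hT : IsTransientSubIntensity T) (hπ0 : ∀ i, 0 ≤ π i) (hπ1 : ∑ i, π i = 1) (r : ι → ℝ) :
    ∀ᵐ ω ∂P, totalReward r (semiMarkov J H) ω < ⊤ := by
  filter_upwards [hJH.ae_totalReward_eq_sum r, hJH.ae_exists_chain_eq_none hT hπ0 hπ1]
    with ω hω ⟨N, hN⟩
  rw [hω N hN]
  refine ENNReal.sum_lt_top.2 fun k _ => ?_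
  rcases J k ω with _ | i
  exacts [ENNReal.zero_lt_top, ENNReal.ofReal_lt_top]

variable {r : ι → ℝ}

theorem restrict_rewardLaw_absolutelyContinuous (hJH : IsMLMarkovRenewal P a π T J H)
    (hT : IsTransientSubIntensity T) (hπ0 : ∀ i, 0 ≤ π i) (hπ1 : ∑ i, π i = 1)
    (hr : ∀ i, 0 ≤ r i) : (rewardLaw P r J H).restrict {0}ᶜ ≪ volume := by
  have := nonempty_of_sum_eq_one hπ1
  have hY := (hJH.aemeasurable_totalReward hT hπ0 hπ1 r).ennreal_toReal
  refine Measure.AbsolutelyContinuous.mk fun A hA hA0 => ?_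
  rw [Measure.restrict_apply hA, rewardLaw,
    Measure.map_apply_of_aemeasurable hY (hA.inter (measurableSet_singleton 0).compl)]
  refine measure_eq_zero_iff_ae_notMem.2 ?_
  have hpaths : ∀ᵐ ω ∂P, ∀ (N : ℕ) (x : Fin N → Option ι),
      ∑ k, ((x k).elim 0 fun i => r i * H i k ω) ∉ A ∩ {0}ᶜ :=
    ae_all_iff.2 fun N => ae_all_iff.2 fun x => hJH.ae_sum_reward_notMem r x
      (measure_inter_null_of_null_left _ hA0) fun h => h.2 rfl
  filter_upwards [hpaths, hJH.ae_toReal_totalReward_eq_sum hr,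
    hJH.ae_exists_chain_eq_none hT hπ0 hπ1] with ω hω hsum ⟨N, hN⟩
  rw [Set.mem_preimage, hsum N hN, Finset.sum_range]
  exact hω N fun k => J k ω

theorem integral_exp_rewardLaw (hJH : IsMLMarkovRenewal P a π T J H) (ha0 : 0 < a) (ha1 : a ≤ 1)
    (hT : IsTransientSubIntensity T) (hπ0 : ∀ i, 0 ≤ π i) (hπ1 : ∑ i, π i = 1)
    (hr : ∀ i, 0 ≤ r i) {u : ℝ} (hu : 0 ≤ u) :
    ∫ x, Real.exp (-u * x) ∂rewardLaw P r J H =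
      π ⬝ᵥ ((Matrix.diagonal (fun i => (u * r i) ^ a) - T)⁻¹ *ᵥ exitRates T) := by
  have hY := (hJH.aemeasurable_totalReward hT hπ0 hπ1 r).ennreal_toReal
  have hexp := (hY.const_mul (-u)).exp
  have hd (i : ι) : 0 ≤ (u * r i) ^ a := Real.rpow_nonneg (mul_nonneg hu (hr i)) a
  have hsurvive (i : ι) :
      ∫⁻ y, ENNReal.ofReal (Real.exp (-(u * r i * y))) ∂mlMeasure a (-T i i) =
        ENNReal.ofReal (-T i i / (-T i i + (u * r i) ^ a)) :=
    have := hJH.isProbabilityMeasure_mlMeasure i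
    lintegral_ofReal_exp_mlMeasure ha0 ha1 (neg_pos.2 (hT.diag_neg i)) (mul_nonneg hu (hr i))
  rw [rewardLaw, integral_map hY (by fun_prop), integral_eq_lintegral_of_nonneg_ae
    (ae_of_all _ fun _ => (Real.exp_pos _).le) hexp.aestronglyMeasurable,
    hJH.lintegral_eq_of_eq_holdProd hT hπ0 hπ1 hd (fun i => by fun_prop) hsurvive
      hexp.ennreal_ofReal (hJH.ae_ofReal_exp_totalReward_eq_holdProd hr u),
    ENNReal.toReal_ofReal]
  exact Finset.sum_nonneg fun i _ => mul_nonneg (hπ0 i)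
    (hT.minimumPrinciple.inv_diagonal_sub_mulVec_nonneg hd hT.exit_nonneg i)

theorem integral_exp_rewardLaw_eq_rewardInit_dotProduct_add
    (hJH : IsMLMarkovRenewal P a π T J H) (ha0 : 0 < a) (ha1 : a ≤ 1)
    (hT : IsTransientSubIntensity T) (hπ0 : ∀ i, 0 ≤ π i) (hπ1 : ∑ i, π i = 1)
    (hr : ∀ i, 0 ≤ r i) {u : ℝ} (hu : 0 ≤ u) :
    ∫ x, Real.exp (-u * x) ∂rewardLaw P r J H =
      rewardInit π T r ⬝ᵥ
        (((u ^ a) • (1 : Matrix (PosPhase r) (PosPhase r) ℝ) - rewardSubIntensity a T r)⁻¹ *ᵥ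
          exitRates (rewardSubIntensity a T r)) + (1 - ∑ i, rewardInit π T r i) := by
  have hMP := hT.minimumPrinciple
  have hd (i : ι) : 0 ≤ (u * r i) ^ a := Real.rpow_nonneg (mul_nonneg hu (hr i)) a
  have hsolve (i : ι) := congrFun
    (mulVec_inv_mulVec_of_isUnit (hMP.isUnit_diagonal_sub hd) (exitRates T)) i
  rw [hJH.integral_exp_rewardLaw ha0 ha1 hT hπ0 hπ1 hr hu]
  set v := (Matrix.diagonal (fun i => (u * r i) ^ a) - T)⁻¹ *ᵥ exitRates T
  simp only [Matrix.sub_mulVec, Pi.sub_apply, Matrix.mulVec_diagonal] at hsolve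
  have hzero (i : ι) (hi : r i = 0) : -(T *ᵥ v) i = exitRates T i := by
    simpa [hi, Real.zero_rpow ha0.ne'] using hsolve i
  rw [dotProduct_eq_rewardInit_dotProduct_add hr hMP π hzero, hπ1,
    posPhase_eq_resolvent_mulVec_exitRates hr hMP ha0.ne' hu hsolve]

lemma isProbabilityMeasure_rewardLaw (hJH : IsMLMarkovRenewal P a π T J H)
    (hT : IsTransientSubIntensity T) (hπ0 : ∀ i, 0 ≤ π i) (hπ1 : ∑ i, π i = 1) :
    IsProbabilityMeasure (rewardLaw P r J H) :=
  Measure.isProbabilityMeasure_map (hJH.aemeasurable_totalReward hT hπ0 hπ1 r).ennreal_toReal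

lemma ae_rewardLaw_nonneg (hJH : IsMLMarkovRenewal P a π T J H)
    (hT : IsTransientSubIntensity T) (hπ0 : ∀ i, 0 ≤ π i) (hπ1 : ∑ i, π i = 1) :
    ∀ᵐ x ∂rewardLaw P r J H, 0 ≤ x :=
  (ae_map_iff (hJH.aemeasurable_totalReward hT hπ0 hπ1 r).ennreal_toReal measurableSet_Ici).2
    (ae_of_all _ fun _ => ENNReal.toReal_nonneg)

theorem rewardLaw_singleton_zero (hJH : IsMLMarkovRenewal P a π T J H) (ha0 : 0 < a)
    (ha1 : a ≤ 1) (hT : IsTransientSubIntensity T) (hπ0 : ∀ i, 0 ≤ π i) (hπ1 : ∑ i, π i = 1)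
    (hr : ∀ i, 0 ≤ r i) :
    rewardLaw P r J H {0} = ENNReal.ofReal (1 - ∑ i, rewardInit π T r i) := by
  have := hJH.isProbabilityMeasure_rewardLaw hT hπ0 hπ1 (r := r)
  rw [← measureReal_singleton_zero_of_laplace ha0
    (hJH.ae_rewardLaw_nonneg hT hπ0 hπ1) fun u hu =>
      hJH.integral_exp_rewardLaw_eq_rewardInit_dotProduct_add ha0 ha1 hT hπ0 hπ1 hr hu,
    ofReal_measureReal]

theorem isFracPhaseType_restrict_rewardLaw (hJH : IsMLMarkovRenewal P a π T J H) (ha0 : 0 < a)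
    (ha1 : a ≤ 1) (hT : IsTransientSubIntensity T) (hπ0 : ∀ i, 0 ≤ π i) (hπ1 : ∑ i, π i = 1)
    (hr : ∀ i, 0 ≤ r i) :
    IsFracPhaseType a (rewardInit π T r) (rewardSubIntensity a T r)
      ((rewardLaw P r J H).restrict {0}ᶜ) := by
  have := hJH.isProbabilityMeasure_rewardLaw hT hπ0 hπ1 (r := r)
  have hnonneg := hJH.ae_rewardLaw_nonneg hT hπ0 hπ1 (r := r)
  exact
    { init_nonneg := rewardInit_nonneg hr hT hπ0
      init_sum_le := hπ1 ▸ sum_rewardInit_le hr hT hπ0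
      subIntensity := isTransientSubIntensity_rewardSubIntensity hr hT a
      isUnit := fun u hu => (minimumPrinciple_rewardSubIntensity hr hT.minimumPrinciple
        a).isUnit_smul_one_sub (Real.rpow_nonneg hu a)
      finite := inferInstance
      nonneg := Measure.restrict_le_self.absolutelyContinuous <|
        measure_eq_zero_iff_ae_notMem.2 <| hnonneg.mono fun x hx => not_lt.2 hx
      laplace := fun u hu => setIntegral_exp_compl_singleton_zero_of_laplace ha0 hnonneg
        (fun _ hu => hJH.integral_exp_rewardLaw_eq_rewardInit_dotProduct_add ha0 ha1 hT hπ0 hπ1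
          hr hu) hu }

end Absorbed

end IsMLMarkovRenewal

end RewardLaw

theorem mainTheorem5 {ι : Type*} [Fintype ι] [DecidableEq ι]
    {Ω : Type*} [MeasurableSpace Ω] (P : Measure Ω) [IsProbabilityMeasure P]
    (a : ℝ) (ha0 : 0 < a) (ha1 : a ≤ 1)
    (π : ι → ℝ) (hπ0 : ∀ i, 0 ≤ π i) (hπ1 : ∑ i, π i = 1)
    (T : Matrix ι ι ℝ) (hT : IsTransientSubIntensity T)
    (J : ℕ → Ω → Option ι) (H : ι → ℕ → Ω → ℝ) (hJH : IsMLMarkovRenewal P a π T J H)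
    (r : ι → ℝ) (hr0 : ∀ i, 0 ≤ r i) (hr : r ≠ 0) :
    IsUnit (-blockZZ r T) ∧
    (∀ᵐ ω ∂P, totalReward r (semiMarkov J H) ω < ⊤) ∧
    ∃ μ : Measure ℝ,
      IsFracPhaseType a (rewardInit π T r) (rewardSubIntensity a T r) μ ∧
      μ ≪ volume ∧
      P.map (fun ω => (totalReward r (semiMarkov J H) ω).toReal)
        = μ + ENNReal.ofReal (1 - ∑ i, rewardInit π T r i) • Measure.dirac 0 := by
  refine ⟨isUnit_neg_blockZZ hr0 hT.minimumPrinciple,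
    hJH.ae_totalReward_lt_top hT hπ0 hπ1 r, (rewardLaw P r J H).restrict {0}ᶜ,
    hJH.isFracPhaseType_restrict_rewardLaw ha0 ha1 hT hπ0 hπ1 hr0,
    hJH.restrict_rewardLaw_absolutelyContinuous hT hπ0 hπ1 hr0, ?_⟩
  rw [← hJH.rewardLaw_singleton_zero ha0 ha1 hT hπ0 hπ1 hr0, ← Measure.restrict_singleton,
    Measure.restrict_compl_add_restrict (measurableSet_singleton 0), rewardLaw]
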